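/- **Setting.** Let $\mathsf T$ be a compactly generated triangulated category (in particular with all small coproducts), with suspension $\Sigma$ and compact objects $\mathsf T^c$. For full subcategories, $\mathsf A^\perp=\{c:\operatorname{Hom}(a,c)=0\ \forall a\in\mathsf A\}$, ${}^\perp\mathsf A=\{c:\operatorname{Hom}(c,a)=0\ \forall a\in\mathsf A\}$, and $\mathsf A\star\mathsf B$ consists of the objects $X$ in a triangle $a\to X\to b\to\Sigma a$ with $a\in\mathsf A$, $b\in\mathsf B$. Let $\operatorname{smd}$ denote closure under direct summands, $\operatorname{coprod}(\mathsf U)$ the closure of $\mathsf U$ under finite direct sums and extensions, $\operatorname{Coprod}_1(\mathsf U)$ the closure of $\mathsf U$ under small coproducts, and $\operatorname{Coprod}_{n+1}(\mathsf U)=\operatorname{Coprod}_1(\mathsf U)\star\operatorname{Coprod}_n(\mathsf U)$. A *generating sequence* is a sequence $\mathcal G=\{\mathcal G^i\}_{i\in\mathbb Z}$ of full subcategories of $\mathsf T^c$ with $\operatorname{smd}(\operatorname{coprod}(\bigcup_i\mathcal G^i))=\mathsf T^c$ and $\Sigma^{-1}\mathcal G^n\cup\mathcal G^n\cup\Sigma\mathcal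 G^n\subseteq\operatorname{smd}(\operatorname{coprod}(\bigcup_{n-1\le i\le n+1}\mathcal G^i))$ for all $n$; it is *finite* if each $\mathcal G^i$ has finitely many objects. Put $\mathcal M^{\mathcal G}_n=\operatorname{smd}(\operatorname{coprod}(\bigcup_{i\le -n}\mathcal G^i))$, $\mathcal R^{\mathcal G}_n={}^\perp\big((\mathcal M^{\mathcal G}_n)^\perp\big)$, and let the *closure of the compacts* be $\overline{\mathsf T^c}=\bigcap_{n\in\mathbb Z}\mathsf T^c\star\mathcal R^{\mathcal G}_n$. An *orthogonal metric* is a sequence $\{\mathcal R_n\}_{n\in\mathbb Z}$ of strictly full subcategories of $\mathsf T$ containing $0$ with $\mathcal R_n\star\mathcal R_n\subseteq\mathcal R_n$, $\Sigma\mathcal R_{n+1}\cup\mathcal R_{n+1}\cup\Sigma^{-1}\mathcal R_{n+1}\subseteq\mathcal R_n$ and ${}^\perp(\mathcal R_n^\perp)=\mathcal R_n$ for all $n$. The category $\mathsf T$ is *$\mathcal G$-quasiapproximable* if there are an orthogonal metric $\mathcal R$ and an integer $A>0$ such that, for all $i,n\in\mathbb Z$: 0. $\mathcal M^{\mathcal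 G}_i\subseteq\bigcup_{|m|\le A}\Sigma^m\mathcal M^{\mathcal G}_{i+1}$; 1. $\mathcal M^{\mathcal G}_{i+A}\subseteq\mathcal R_i\cap\mathsf T^c$; 2. $\operatorname{Hom}(\mathcal G^n,\mathcal R_i)=0$ whenever $n+i\ge A$; 3. every $F\in\mathcal R_i\cap\overline{\mathsf T^c}$ lies in a triangle $E\to F\to D\to\Sigma E$ with $D\in\mathcal R_{i+1}\cap\overline{\mathsf T^c}$ and $E\in\operatorname{smd}\big(\operatorname{Coprod}_A(\bigcup_{-A-i\le j\le A-i}\mathcal G^j)\big)$. If $\mathsf T$ is $R$-linear for a commutative ring $R$, a *$\mathsf T^c$-cohomological functor* is an $R$-linear functor $H:(\mathsf T^c)^{\mathrm{op}}\to\operatorname{Mod}(R)$ such that $H(Z)\to H(Y)\to H(X)$ is exact for every triangle $X\to Y\to Z\to\Sigma X$ with $X,Y,Z\in\mathsf T^c$. It is *$\mathcal G$-semifinite* if $H(X)$ is a finitely generated $R$-module for every $X\in\mathsf T^c$ and there is $N$ with $H(G)=0$ for all $i\ge N$ and all $G\in\mathcal G^i$. **Theorem.** Let $\mathsf T$ be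 $\mathcal G$-quasiapproximable for a finite generating sequence $\mathcal G$. Assume that $\mathsf T$ is an $R$-linear triangulated category for a commutative noetherian ring $R$, and that $\operatorname{Hom}_{\mathsf T}(G,G')$ is a finitely generated $R$-module for all $G,G'\in\bigcup_n\mathcal G^n$. Then the restricted Yoneda functor $$\mathcal Y:\overline{\mathsf T^c}\longrightarrow\operatorname{Hom}\big((\mathsf T^c)^{\mathrm{op}},\operatorname{Mod}(R)\big),\qquad F\longmapsto\operatorname{Hom}_{\mathsf T}(-,F)|_{\mathsf T^c},$$ satisfies: 1. the essential image of $\mathcal Y$ consists exactly of the $\mathcal G$-semifinite $\mathsf T^c$-cohomological functors; 2. $\mathcal Y$ is full. -/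

import Mathlib

open CategoryTheory CategoryTheory.Limits CategoryTheory.Pretriangulated Opposite

universe w v u

noncomputable section

namespace GApprox

variable {C : Type u} [Category.{v} C] [Preadditive C]

/-- Compact objects: `Hom(X, -)` commutes with (small) coproducts. -/
def compacts (C : Type u) [Category.{v} C] [Preadditive C] : ObjectProperty C :=
  fun X ↦ ∀ J : Type v, PreservesColimitsOfShape (Discrete J) (preadditiveCoyoneda.obj (op X))

/-- `add(U)`: the finite direct sums (the empty one included) of objects of `U`. -/
def finiteSums (U : ObjectProperty C) : ObjectProperty C :=
  fun X ↦ ∃ n : ℕ, U.colimitsOfShape (Discrete (Fin n)) X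

/-- `Add(U)`: the arbitrary small coproducts of objects of `U`. -/
def allSums (U : ObjectProperty C) : ObjectProperty C :=
  fun X ↦ ∃ J : Type v, U.colimitsOfShape (Discrete J) X

/-- For a sequence `G` of full subcategories, `G(s)` is the union of the `G n` with `n ∈ s`. -/
def union (G : ℤ → ObjectProperty C) (s : Set ℤ) : ObjectProperty C :=
  fun X ↦ ∃ n ∈ s, G n X

variable [HasZeroObject C] [HasShift C ℤ] [∀ n : ℤ, (shiftFunctor C n).Additive]
  [Pretriangulated C]

/-- `T` is compactly generated: some small set of compact objects detects zero objects
(the existence of coproducts is assumed separately). -/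
def IsCompactlyGenerated (C : Type u) [Category.{v} C] [Preadditive C] [HasZeroObject C]
    [HasShift C ℤ] [∀ n : ℤ, (shiftFunctor C n).Additive] [Pretriangulated C] : Prop :=
  ∃ S : ObjectProperty C, ObjectProperty.Small.{v} S ∧ S ≤ compacts C ∧
    ∀ Y : C, (∀ X : C, S X → ∀ (n : ℤ) (f : X⟦n⟧ ⟶ Y), f = 0) → IsZero Y

/-- `coprod(U)`: the closure of `U` under finite direct sums and extensions. -/
inductive coprod (U : ObjectProperty C) : C → Prop
  | of_mem (X : C) (hX : U X) : coprod U X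
  | sum (n : ℕ) (Y : Fin n → C) (c : Cofan Y) (hc : IsColimit c)
      (hY : ∀ i, coprod U (Y i)) : coprod U c.pt
  | ext (T : Triangle C) (hT : T ∈ distTriang C)
      (h₁ : coprod U T.obj₁) (h₃ : coprod U T.obj₃) : coprod U T.obj₂

/-- `Coprod_n(U)` for `n ≥ 1`: `Coprod_1(U) = Add(U)` and
`Coprod_{n+1}(U) = Add(U) ⋆ Coprod_n(U)`. (The value at `n = 0` is not used.) -/
def bigCoprod (U : ObjectProperty C) (n : ℕ) : ObjectProperty C :=
  (allSums U).extensionProductIter (n - 1)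

/-- The small category `smd(coprod(G(s)))`. -/
def smallGen (G : ℤ → ObjectProperty C) (s : Set ℤ) : ObjectProperty C :=
  ObjectProperty.retractClosure (coprod (union G s))

/-- The big category `smd(Coprod_n(G(s)))`, for `n ≥ 1`. -/
def bigGen (G : ℤ → ObjectProperty C) (s : Set ℤ) (n : ℕ) : ObjectProperty C :=
  (bigCoprod (union G s) n).retractClosure

/-- A generating sequence of full subcategories of the compact objects. -/
structure IsGeneratingSequence (G : ℤ → ObjectProperty C) : Prop where
  le_compacts (n : ℤ) : G n ≤ compacts C
  generates : smallGen G Set.univ = compacts C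
  shift_neg (n : ℤ) (X : C) (hX : G n X) :
    smallGen G (Set.Icc (n - 1) (n + 1)) (X⟦(-1 : ℤ)⟧)
  self (n : ℤ) (X : C) (hX : G n X) : smallGen G (Set.Icc (n - 1) (n + 1)) X
  shift_pos (n : ℤ) (X : C) (hX : G n X) :
    smallGen G (Set.Icc (n - 1) (n + 1)) (X⟦(1 : ℤ)⟧)

/-- A finite generating sequence: each `G n` has only finitely many objects. -/
structure IsFiniteGeneratingSequence (G : ℤ → ObjectProperty C) : Prop
    extends IsGeneratingSequence G where
  finite (n : ℤ) : Set.Finite {X : C | G n X}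

/-- The metric `M^G_n = smd(coprod(G(-∞, -n]))` on the compact objects. -/
def metricM (G : ℤ → ObjectProperty C) (n : ℤ) : ObjectProperty C :=
  smallGen G (Set.Iic (-n))

/-- The metric `R^G_n = ^⊥((M^G_n)^⊥)`. -/
def metricR (G : ℤ → ObjectProperty C) (n : ℤ) : ObjectProperty C :=
  (metricM G n).rightOrthogonal.leftOrthogonal

/-- An extended good metric. -/
structure IsExtendedGoodMetric (M : ℤ → ObjectProperty C) : Prop where
  iso_closed (n : ℤ) : (M n).IsClosedUnderIsomorphisms
  zero (n : ℤ) : (M n).ContainsZero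
  ext (n : ℤ) : (M n).extensionProduct (M n) ≤ M n
  shift_pos (n : ℤ) (X : C) (hX : M (n + 1) X) : M n (X⟦(1 : ℤ)⟧)
  self (n : ℤ) : M (n + 1) ≤ M n
  shift_neg (n : ℤ) (X : C) (hX : M (n + 1) X) : M n (X⟦(-1 : ℤ)⟧)

/-- An orthogonal metric: an extended good metric with `^⊥(M_n^⊥) = M_n`. -/
structure IsOrthogonalMetric (M : ℤ → ObjectProperty C) : Prop
    extends IsExtendedGoodMetric M where
  orthogonal (n : ℤ) : (M n).rightOrthogonal.leftOrthogonal = M n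

/-- The closure of the compacts with respect to a metric: `⋂ n, T^c ⋆ M_n`. -/
def closureOfCompacts (M : ℤ → ObjectProperty C) : ObjectProperty C :=
  fun X ↦ ∀ n : ℤ, (compacts C).extensionProduct (M n) X

/-- The closure of the compacts of a category with a generating sequence `G`:
it is taken with respect to the metric `R^G`. -/
def closureG (G : ℤ → ObjectProperty C) : ObjectProperty C :=
  closureOfCompacts (metricR G)

/-- The orthogonal metric `R` and the integer `A` witness `G`-preapproximability. -/
structure IsPreapproximableWith (G : ℤ → ObjectProperty C) (R : ℤ → ObjectProperty C)
    (A : ℕ) : Prop where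
  pos : 0 < A
  metric : IsOrthogonalMetric R
  /-- `M^G_i ⊆ ⋃_{|n| ≤ A} Σ^n M^G_{i+1}` -/
  shift_bound (i : ℤ) (X : C) (hX : metricM G i X) :
    ∃ n : ℤ, |n| ≤ (A : ℤ) ∧ ∃ Y : C, metricM G (i + 1) Y ∧ Nonempty (X ≅ Y⟦n⟧)
  metricM_le (i : ℤ) : metricM G (i + A) ≤ R i ⊓ compacts C
  hom_eq_zero (n : ℤ) : ∃ N : ℤ, ∀ i : ℤ, N ≤ i → R i ≤ (G n).rightOrthogonal

/-- The orthogonal metric `R` and the integer `A` witness `G`-quasiapproximability. -/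
structure IsQuasiapproximableWith (G : ℤ → ObjectProperty C) (R : ℤ → ObjectProperty C)
    (A : ℕ) : Prop extends IsPreapproximableWith G R A where
  hom_eq_zero_of_le (n i : ℤ) (h : (A : ℤ) ≤ n + i) : R i ≤ (G n).rightOrthogonal
  approx (i : ℤ) (F : C) (hF : R i F) (hF' : closureG G F) :
    ∃ (E D : C) (a : E ⟶ F) (b : F ⟶ D) (c : D ⟶ E⟦(1 : ℤ)⟧),
      Triangle.mk a b c ∈ distTriang C ∧
      bigGen G (Set.Icc (-A - i) (A - i)) A E ∧ R (i + 1) D ∧ closureG G D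

/-- `T` is `G`-quasiapproximable. -/
def IsQuasiapproximable (G : ℤ → ObjectProperty C) : Prop :=
  ∃ (R : ℤ → ObjectProperty C) (A : ℕ), IsQuasiapproximableWith G R A

variable (k : Type w) [CommRing k] [Linear k C]

/-- `T^c`-cohomological functors: `k`-linear functors `H : (T^c)ᵒᵖ ⥤ Mod(k)` such that
`H(Z) ⟶ H(Y) ⟶ H(X)` is exact for each distinguished triangle `X ⟶ Y ⟶ Z ⟶ ΣX`
with `X`, `Y` and `Z` compact. -/
structure IsCohomological (H : (compacts C).FullSubcategoryᵒᵖ ⥤ ModuleCat.{v} k) : Prop where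
  additive : H.Additive
  map_smul {X Y : (compacts C).FullSubcategory} (r : k) (f : X ⟶ Y) :
    H.map (r • f).op = r • H.map f.op
  exact {X Y Z : (compacts C).FullSubcategory} (f : X ⟶ Y) (g : Y ⟶ Z)
    (h : Z.obj ⟶ X.obj⟦(1 : ℤ)⟧) (hT : Triangle.mk f.hom g.hom h ∈ distTriang C) :
    Function.Exact (H.map g.op).hom (H.map f.op).hom

/-- `G`-semifinite `T^c`-cohomological functors: the values are finitely generated modules,
and `H(G^i) = 0` for `i ≫ 0`. -/
structure IsSemifinite (G : ℤ → ObjectProperty C)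
    (H : (compacts C).FullSubcategoryᵒᵖ ⥤ ModuleCat.{v} k) : Prop
    extends IsCohomological k H where
  finite (X : (compacts C).FullSubcategory) : Module.Finite k (H.obj (op X))
  vanishing : ∃ N : ℤ, ∀ i : ℤ, N ≤ i → ∀ X : (compacts C).FullSubcategory, G i X.obj →
    Subsingleton (H.obj (op X))

/-- The restricted Yoneda functor `F ↦ Hom(-, F)|_{T^c}` on the closure of the compacts. -/
def restrictedYoneda (G : ℤ → ObjectProperty C) :
    (closureG G).FullSubcategory ⥤
      ((compacts C).FullSubcategoryᵒᵖ ⥤ ModuleCat.{v} k) :=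
  (closureG G).ι ⋙ linearYoneda k C ⋙
    (Functor.whiskeringLeft _ _ _).obj (compacts C).ι.op

end GApprox

end

/-! Everything rests on an intrinsic description of the closure of the compacts: `F` lies in it
exactly when Hom(Q, F) is finitely generated for every compact Q (`HomFinite`) and Hom(G^n, F) = 0
for n ≫ 0 (`VanishesFrom`). Necessity is short. In a triangle E → F → D with E compact and D in
R^G_n, both ends lie in some R^G_b, which receives no maps from G^n for n ≫ 0; and when n is large,
a given compact Q has no maps to D, so Hom(Q, E) → Hom(Q, F) is onto.

Both claims then follow from homotopy colimits. A semifinite H should be represented by the colimit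
of the pairs (E, x) with E compact and x in H(E). Since k is noetherian and each G^i is finite, one
sequence of pairs suffices: each stage has finitely many elements to hit and finitely many relations
to kill (`exists_approxSeq`). Its homotopy colimit represents H (`exists_iso_of_isHocolim`), and by
the description it lies in the closure. Applied to H = Hom(-, F), the construction exhibits F as a
homotopy colimit of compacts; a natural transformation out of Hom(-, F) gives compatible maps on the
terms, hence a morphism out of F, which is fullness (`exists_map_eq_of_isHocolim`).

Sufficiency in the description is the hard part. Maps from compacts to F factor through compacts in
one fixed R^G_b (`exists_factorization`), so F lies in some R^G (`metricR_of_vanishesFrom`). On a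
finite range of indices, choose compacts E₀ → E₁ over F such that E₀ hits all of Hom(Q, F) and E₁
kills the kernel. Lifting E₁, up to a deep error, back to E₀ gives an endomorphism e of Hom(Q, E₁)
which is idempotent with image Hom(Q, F). The cone of 1 - e is compact and agrees with F ⊕ ΣF on
this range, so F ⊕ ΣF is in the closure (`eq_zero_of_biprod_cone`, `closureG_biprod_shift`). Closure
under extensions turns ΣF into any odd shift of F, and condition 0 makes a suitable odd shift as
deep as desired, so it can be discarded (`closureG_of_vanishesFrom`). -/

noncomputable section

namespace GApprox

set_option linter.unusedSectionVars false

/-! ### Compact objects and finite supports of maps into coproducts -/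

section Compacts

variable {C : Type u} [Category.{v} C] [Preadditive C] [HasCoproducts.{v} C]

open Classical in
/-- The endomorphism of a coproduct which is the identity on the summands indexed by `S` and
zero on the other ones. -/
def sigmaPart {J : Type v} (f : J → C) (S : Finset J) : ∐ f ⟶ ∐ f :=
  ∑ j ∈ S, Sigma.π f j ≫ Sigma.ι f j

lemma ι_sigmaPart_of_mem {J : Type v} (f : J → C) {S : Finset J} {j : J} (hj : j ∈ S) :
    Sigma.ι f j ≫ sigmaPart f S = Sigma.ι f j := by
  classical
  rw [sigmaPart, Preadditive.comp_sum, Finset.sum_eq_single j]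
  · simp
  · intro b _ hb
    rw [Sigma.ι_π_of_ne_assoc _ hb.symm, zero_comp]
  · exact fun h ↦ (h hj).elim

lemma ι_sigmaPart_of_notMem {J : Type v} (f : J → C) {S : Finset J} {j : J} (hj : j ∉ S) :
    Sigma.ι f j ≫ sigmaPart f S = 0 := by
  classical
  rw [sigmaPart, Preadditive.comp_sum]
  refine Finset.sum_eq_zero fun b hb ↦ ?_
  rw [Sigma.ι_π_of_ne_assoc _ (ne_of_mem_of_not_mem hb hj).symm, zero_comp]

lemma sigmaPart_comp {J : Type v} (f : J → C) {S S' : Finset J} (h : S ⊆ S') :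
    sigmaPart f S ≫ sigmaPart f S' = sigmaPart f S := by
  ext j
  by_cases hj : j ∈ S
  · rw [← Category.assoc, ι_sigmaPart_of_mem f hj, ι_sigmaPart_of_mem f (h hj)]
  · rw [← Category.assoc, ι_sigmaPart_of_notMem f hj, zero_comp]

/-- Every morphism from `X` to a coproduct factors through a finite partial sum. -/
def HasFiniteSupports (X : C) : Prop :=
  ∀ (J : Type v) (f : J → C) (z : X ⟶ ∐ f), ∃ S : Finset J, z ≫ sigmaPart f S = z

lemma comp_sigmaPart_mono {J : Type v} {f : J → C} {X : C} {z : X ⟶ ∐ f} {S S' : Finset J}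
    (h : S ⊆ S') (hz : z ≫ sigmaPart f S = z) : z ≫ sigmaPart f S' = z := by
  rw [← hz, Category.assoc, sigmaPart_comp f h]

/-- The finitely supported maps form a subgroup `N` containing everything that comes from a single
summand. The quotient map by `N` therefore vanishes on each summand of the coproduct of groups
Hom(X, ∐ f), so it is zero. -/
lemma hasFiniteSupports_of_compacts {X : C} (hX : compacts C X) : HasFiniteSupports X := by
  classical
  intro J f z
  have := hX J
  let N : AddSubgroup (X ⟶ ∐ f) :=
    { carrier := {z | ∃ S : Finset J, z ≫ sigmaPart f S = z}
      zero_mem' := ⟨∅, by simp⟩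
      add_mem' := by
        rintro a b ⟨S, hS⟩ ⟨S', hS'⟩
        refine ⟨S ∪ S', ?_⟩
        rw [Preadditive.add_comp, comp_sigmaPart_mono Finset.subset_union_left hS,
          comp_sigmaPart_mono Finset.subset_union_right hS']
      neg_mem' := by
        rintro a ⟨S, hS⟩
        exact ⟨S, by rw [Preadditive.neg_comp, hS]⟩ }
  have hc := isColimitCofanMkObjOfIsColimit (preadditiveCoyoneda.obj (op X)) f (Sigma.ι f)
    (coproductIsCoproduct f)
  have key : (AddCommGrpCat.ofHom (QuotientAddGroup.mk' N) :
      (preadditiveCoyoneda.obj (op X)).obj (∐ f) ⟶ AddCommGrpCat.of ((X ⟶ ∐ f) ⧸ N)) = 0 := by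
    refine Cofan.IsColimit.hom_ext hc _ _ fun j ↦ ?_
    ext (y : X ⟶ f j)
    change QuotientAddGroup.mk' N (y ≫ Sigma.ι f j) = 0
    rw [QuotientAddGroup.mk'_apply, QuotientAddGroup.eq_zero_iff]
    exact ⟨{j}, by rw [Category.assoc, ι_sigmaPart_of_mem f (Finset.mem_singleton_self j)]⟩
  have hz : QuotientAddGroup.mk' N z = 0 :=
    DFunLike.congr_fun (congrArg AddCommGrpCat.Hom.hom key) z
  rw [QuotientAddGroup.mk'_apply, QuotientAddGroup.eq_zero_iff] at hz
  exact hz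

/-- A finitely supported map is the sum of its components, so homomorphisms on the groups Hom(X, f
j) extend uniquely to Hom(X, ∐ f) by summing over any finite set containing the support. -/
lemma compacts_of_hasFiniteSupports {X : C} (hX : HasFiniteSupports X) : compacts C X := by
  classical
  intro J
  have : ∀ f : J → C, PreservesColimit (Discrete.functor f) (preadditiveCoyoneda.obj (op X)) := by
    intro f
    have hfs : ∀ (z : X ⟶ ∐ f), ∃ S : Finset J, ∀ j ∉ S, z ≫ Sigma.π f j = 0 := fun z ↦ by
      obtain ⟨S, hS⟩ := hX J f z
      refine ⟨S, fun j hj ↦ ?_⟩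
      rw [← hS, sigmaPart, Preadditive.comp_sum, Preadditive.sum_comp]
      refine Finset.sum_eq_zero fun b hb ↦ ?_
      rw [Category.assoc, Category.assoc, Sigma.ι_π_of_ne _ (ne_of_mem_of_not_mem hb hj), comp_zero,
        comp_zero]
    have hdec : ∀ (z : X ⟶ ∐ f) (S : Finset J), (∀ j ∉ S, z ≫ Sigma.π f j = 0) →
        z = ∑ j ∈ S, (z ≫ Sigma.π f j) ≫ Sigma.ι f j := fun z S hS ↦ by
      obtain ⟨S', hS'⟩ := hX J f z
      have h1 := comp_sigmaPart_mono (Finset.subset_union_right (s₁ := S)) hS'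
      conv_lhs => rw [← h1, sigmaPart, Preadditive.comp_sum]
      rw [← Finset.sum_subset (Finset.subset_union_left (s₂ := S'))]
      · simp
      · intro j _ hj
        rw [← Category.assoc, hS j hj, zero_comp]
    have hdesc : ∀ (A : Type v) [AddCommGroup A] (g : ∀ j, (X ⟶ f j) →+ A),
        ∃ φ : (X ⟶ ∐ f) →+ A, ∀ j y, φ (y ≫ Sigma.ι f j) = g j y := by
      intro A _ g
      have key : ∀ (z : X ⟶ ∐ f) (S S' : Finset J), (∀ j ∉ S, z ≫ Sigma.π f j = 0) → S ⊆ S' →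
          ∑ j ∈ S, g j (z ≫ Sigma.π f j) = ∑ j ∈ S', g j (z ≫ Sigma.π f j) :=
        fun z S S' hS hSS' ↦ Finset.sum_subset hSS' fun j _ hj ↦ by rw [hS j hj, map_zero]
      refine ⟨AddMonoidHom.mk' (fun z ↦ ∑ j ∈ (hfs z).choose, g j (z ≫ Sigma.π f j))
        fun a b ↦ ?_, fun j y ↦ ?_⟩
      · let U := (hfs (a + b)).choose ∪ ((hfs a).choose ∪ (hfs b).choose)
        rw [key _ _ U (hfs (a + b)).choose_spec Finset.subset_union_left,
          key _ _ U (hfs a).choose_spec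
            (Finset.subset_union_left.trans Finset.subset_union_right),
          key _ _ U (hfs b).choose_spec
            (Finset.subset_union_right.trans Finset.subset_union_right), ← Finset.sum_add_distrib]
        refine Finset.sum_congr rfl fun j _ ↦ ?_
        rw [Preadditive.add_comp, map_add]
      · change ∑ i ∈ (hfs (y ≫ Sigma.ι f j)).choose, g i ((y ≫ Sigma.ι f j) ≫ Sigma.π f i) = g j y
        rw [Finset.sum_eq_single j]
        · rw [Category.assoc, Sigma.ι_π_eq_id, Category.comp_id]
        · intro b _ hb
          rw [Category.assoc, Sigma.ι_π_of_ne _ hb.symm, comp_zero, map_zero]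
        · intro h
          rw [(hfs (y ≫ Sigma.ι f j)).choose_spec j h, map_zero]
    refine preservesColimit_of_preserves_colimit_cocone (coproductIsCoproduct f)
      ((isColimitMapCoconeCofanMkEquiv (preadditiveCoyoneda.obj (op X)) f (Sigma.ι f)).symm ?_)
    have hd := fun (s : Cofan fun j ↦ (preadditiveCoyoneda.obj (op X)).obj (f j)) ↦
      hdesc s.pt fun j ↦ (s.inj j).hom
    refine Cofan.IsColimit.mk _ (fun s ↦ AddCommGrpCat.ofHom (hd s).choose) ?_ ?_
    · intro s j
      ext (y : X ⟶ f j)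
      exact (hd s).choose_spec j y
    · intro s m hm
      ext (z : X ⟶ ∐ f)
      obtain ⟨S, hS⟩ := hfs z
      have h1 : ∀ φ : (X ⟶ ∐ f) →+ s.pt, (∀ j y, φ (y ≫ Sigma.ι f j) = (s.inj j).hom y) →
          φ z = ∑ j ∈ S, (s.inj j).hom (z ≫ Sigma.π f j) := fun φ hφ ↦ by
        conv_lhs => rw [hdec z S hS, map_sum]
        exact Finset.sum_congr rfl fun j _ ↦ hφ j _
      exact (h1 m.hom fun j y ↦ DFunLike.congr_fun (congrArg AddCommGrpCat.Hom.hom (hm j)) y).trans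
        (h1 _ (hd s).choose_spec).symm
  exact preservesColimitsOfShape_of_discrete _

lemma compacts_iff (X : C) : compacts C X ↔ HasFiniteSupports X :=
  ⟨hasFiniteSupports_of_compacts, compacts_of_hasFiniteSupports⟩

lemma compacts_of_retract {X Y : C} (r : Retract X Y) (hY : compacts C Y) : compacts C X := by
  rw [compacts_iff] at hY ⊢
  intro J f z
  obtain ⟨S, hS⟩ := hY J f (r.r ≫ z)
  refine ⟨S, ?_⟩
  have := congrArg (fun t ↦ r.i ≫ t) hS
  simpa using this

lemma compacts_of_isZero {X : C} (hX : IsZero X) : compacts C X :=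
  (compacts_iff X).2 fun _ _ _ ↦ ⟨∅, hX.eq_of_src _ _⟩

variable [HasZeroObject C] [HasShift C ℤ] [∀ n : ℤ, (shiftFunctor C n).Additive]
  [Pretriangulated C]

lemma compacts_obj₂ {T : Triangle C} (hT : T ∈ distTriang C) (h₁ : compacts C T.obj₁)
    (h₃ : compacts C T.obj₃) : compacts C T.obj₂ := by
  classical
  rw [compacts_iff] at *
  intro J f z
  obtain ⟨S, hS⟩ := h₁ J f (T.mor₁ ≫ z)
  obtain ⟨w, hw⟩ := Triangle.yoneda_exact₂ T hT (z - z ≫ sigmaPart f S) (by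
    rw [Preadditive.comp_sub, ← Category.assoc, hS, sub_self])
  obtain ⟨S', hS'⟩ := h₃ J f w
  refine ⟨S ∪ S', ?_⟩
  have h1 : (z - z ≫ sigmaPart f S) ≫ sigmaPart f (S ∪ S') = z - z ≫ sigmaPart f S := by
    rw [hw, Category.assoc, comp_sigmaPart_mono Finset.subset_union_right hS']
  rw [Preadditive.sub_comp, Category.assoc, sigmaPart_comp f Finset.subset_union_left] at h1
  exact sub_left_injective h1

lemma compacts_shift {X : C} (hX : compacts C X) (n : ℤ) : compacts C (X⟦n⟧) := by
  intro J
  have := hX J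
  have : (shiftEquiv C n).functor.Additive := inferInstanceAs (shiftFunctor C n).Additive
  let e : preadditiveCoyoneda.obj (op (X⟦n⟧)) ≅
      shiftFunctor C (-n) ⋙ preadditiveCoyoneda.obj (op X) :=
    NatIso.ofComponents (fun Y ↦ AddEquiv.toAddCommGrpIso
      ((shiftEquiv C n).toAdjunction.homAddEquiv X Y)) (fun {Y Z} f ↦ by
        ext (g : X⟦n⟧ ⟶ Y)
        exact (shiftEquiv C n).toAdjunction.homEquiv_naturality_right g f)
  exact preservesColimitsOfShape_of_natIso e.symm

lemma compacts_obj₃ {T : Triangle C} (hT : T ∈ distTriang C) (h₁ : compacts C T.obj₁)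
    (h₂ : compacts C T.obj₂) : compacts C T.obj₃ :=
  compacts_obj₂ (rot_of_distTriang _ hT) h₂ (compacts_shift h₁ 1)

lemma compacts_obj₁ {T : Triangle C} (hT : T ∈ distTriang C) (h₂ : compacts C T.obj₂)
    (h₃ : compacts C T.obj₃) : compacts C T.obj₁ :=
  compacts_obj₂ (inv_rot_of_distTriang _ hT) (compacts_shift h₃ (-1)) h₂

lemma compacts_biprod {X Y : C} (hX : compacts C X) (hY : compacts C Y) : compacts C (X ⊞ Y) :=
  compacts_obj₂ (binaryBiproductTriangle_distinguished X Y) hX hY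

end Compacts

/-! ### Homotopy colimits of sequences -/

section Hocolim

variable {C : Type u} [Category.{v} C] [Preadditive C] [HasZeroObject C] [HasShift C ℤ]
  [∀ n : ℤ, (shiftFunctor C n).Additive] [Pretriangulated C]

section

variable {X Y Z : C} {f : X ⟶ Y} {g : Y ⟶ Z} {h : Z ⟶ X⟦(1 : ℤ)⟧}
  (hT : Triangle.mk f g h ∈ distTriang C)
include hT

lemma dist_comp₁₂ : f ≫ g = 0 := comp_distTriang_mor_zero₁₂ _ hT

lemma dist_comp₂₃ : g ≫ h = 0 := comp_distTriang_mor_zero₂₃ _ hT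

lemma dist_comp₃₁ : h ≫ f⟦(1 : ℤ)⟧' = 0 := comp_distTriang_mor_zero₃₁ _ hT

lemma dist_lift₂ {Q : C} (q : Q ⟶ Y) (hq : q ≫ g = 0) : ∃ p : Q ⟶ X, p ≫ f = q := by
  obtain ⟨p, hp⟩ := Triangle.coyoneda_exact₂ _ hT q hq
  exact ⟨p, hp.symm⟩

lemma dist_lift₃ {Q : C} (q : Q ⟶ Z) (hq : q ≫ h = 0) : ∃ p : Q ⟶ Y, p ≫ g = q := by
  obtain ⟨p, hp⟩ := Triangle.coyoneda_exact₃ _ hT q hq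
  exact ⟨p, hp.symm⟩

lemma dist_lift₁ {Q : C} (q : Q ⟶ X⟦(1 : ℤ)⟧) (hq : q ≫ f⟦(1 : ℤ)⟧' = 0) :
    ∃ p : Q ⟶ Z, p ≫ h = q := by
  obtain ⟨p, hp⟩ := Triangle.coyoneda_exact₁ _ hT q hq
  exact ⟨p, hp.symm⟩

lemma dist_desc₂ {Q : C} (q : Y ⟶ Q) (hq : f ≫ q = 0) : ∃ p : Z ⟶ Q, g ≫ p = q := by
  obtain ⟨p, hp⟩ := Triangle.yoneda_exact₂ _ hT q hq
  exact ⟨p, hp.symm⟩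

lemma dist_desc₃ {Q : C} (q : Z ⟶ Q) (hq : g ≫ q = 0) : ∃ p : X⟦(1 : ℤ)⟧ ⟶ Q, h ≫ p = q := by
  obtain ⟨p, hp⟩ := Triangle.yoneda_exact₃ _ hT q hq
  exact ⟨p, hp.symm⟩

end

lemma exists_unshift {Q W : C} (y : Q ⟶ W⟦(1 : ℤ)⟧) :
    ∃ y' : Q⟦(-1 : ℤ)⟧ ⟶ W, y = (shiftNegShift Q (1 : ℤ)).inv ≫ y'⟦(1 : ℤ)⟧' :=
  ⟨(shiftFunctor C (1 : ℤ)).preimage ((shiftNegShift Q (1 : ℤ)).hom ≫ y), by simp⟩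

lemma forall_shift_eq_zero_iff {X Y : C} {n m : ℤ} (h : n + m = 0) :
    (∀ f : X⟦n⟧ ⟶ Y, f = 0) ↔ ∀ f : X ⟶ Y⟦m⟧, f = 0 := by
  constructor
  · intro H f
    refine (shiftFunctor C n).map_injective ?_
    rw [← cancel_mono ((shiftFunctorCompIsoId C m n (by lia)).hom.app Y), H (_ ≫ _),
      Functor.map_zero, zero_comp]
  · intro H f
    refine (shiftFunctor C m).map_injective ?_
    rw [← cancel_epi ((shiftFunctorCompIsoId C n m h).inv.app X), H (_ ≫ _),
      Functor.map_zero, comp_zero]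

/-- `L`, with the maps `i j : X.obj j ⟶ L`, has the properties of the homotopy colimit of the
sequence `X`. -/
structure IsHocolim (X : ℕ ⥤ C) (L : C) (i : ∀ j, X.obj j ⟶ L) : Prop where
  comp (j l : ℕ) (h : j ≤ l) : X.map (homOfLE h) ≫ i l = i j
  exists_lift (Q : C) (hQ : compacts C Q) (q : Q ⟶ L) :
    ∃ (j : ℕ) (y : Q ⟶ X.obj j), y ≫ i j = q
  exists_eq_zero (Q : C) (hQ : compacts C Q) (j : ℕ) (y : Q ⟶ X.obj j) (hy : y ≫ i j = 0) :
    ∃ (l : ℕ) (h : j ≤ l), y ≫ X.map (homOfLE h) = 0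
  exists_desc (Y : C) (φ : ∀ j, X.obj j ⟶ Y)
    (hφ : ∀ j, X.map (homOfLE j.le_succ) ≫ φ (j + 1) = φ j) :
    ∃ f : L ⟶ Y, ∀ j, i j ≫ f = φ j
  eq_zero (Y : C) (h₀ : ∀ j (φ : X.obj j ⟶ Y), φ = 0)
    (h₁ : ∀ j (φ : (X.obj j)⟦(1 : ℤ)⟧ ⟶ Y), φ = 0) (f : L ⟶ Y) : f = 0

variable [HasCoproducts.{v} C]

/-- `L` is the cone of 1 - s on the coproduct of the terms, where `s` is the shift along the
transition maps. The universal property is only weak, and `eq_zero` needs the suspended terms,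
because the suspended coproduct also contributes to the cone. -/
lemma exists_isHocolim (X : ℕ ⥤ C) : ∃ (L : C) (i : ∀ j, X.obj j ⟶ L), IsHocolim X L i := by
  classical
  let f : ULift.{v} ℕ → C := fun j ↦ X.obj j.down
  let inc (j : ℕ) : X.obj j ⟶ ∐ f := Sigma.ι f ⟨j⟩
  let pr (j : ℕ) : ∐ f ⟶ X.obj j := Sigma.π f ⟨j⟩
  let s : ∐ f ⟶ ∐ f := Sigma.desc fun j ↦ X.map (homOfLE j.down.le_succ) ≫ inc (j.down + 1)
  have inc_s (j : ℕ) : inc j ≫ s = X.map (homOfLE j.le_succ) ≫ inc (j + 1) :=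
    Sigma.ι_desc _ _
  have ext' {Y : C} (a b : ∐ f ⟶ Y) (h : ∀ j, inc j ≫ a = inc j ≫ b) : a = b :=
    Sigma.hom_ext _ _ fun j ↦ h j.down
  have inc_pr (j : ℕ) : inc j ≫ pr j = 𝟙 _ := Sigma.ι_π_eq_id f ⟨j⟩
  have inc_pr_ne (j l : ℕ) (h : j ≠ l) : inc j ≫ pr l = 0 :=
    Sigma.ι_π_of_ne f (fun e ↦ h (congrArg ULift.down e))
  have s_pr_zero : s ≫ pr 0 = 0 := ext' _ _ fun j ↦ by
    rw [← Category.assoc, inc_s, Category.assoc, inc_pr_ne _ _ (by lia), comp_zero, comp_zero]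
  have s_pr_succ (l : ℕ) : s ≫ pr (l + 1) = pr l ≫ X.map (homOfLE l.le_succ) := ext' _ _ fun j ↦ by
    rw [← Category.assoc, inc_s, Category.assoc]
    by_cases h : j = l
    · subst h
      rw [inc_pr, ← Category.assoc, inc_pr, Category.comp_id, Category.id_comp]
    · rw [inc_pr_ne _ _ (by lia), ← Category.assoc (inc j), inc_pr_ne _ _ h, comp_zero, zero_comp]
  have supp {Q : C} (hQ : compacts C Q) (z : Q ⟶ ∐ f) :
      ∃ N : ℕ, z = ∑ j ∈ Finset.range N, (z ≫ pr j) ≫ inc j := by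
    obtain ⟨S, hS⟩ := (compacts_iff Q).1 hQ _ f z
    obtain ⟨N, hN⟩ := (S.image ULift.down).exists_nat_subset_range
    refine ⟨N, ?_⟩
    have hsub : S ⊆ (Finset.range N).map ⟨ULift.up.{v}, ULift.up_injective⟩ := fun j hj ↦
      Finset.mem_map.2 ⟨j.down, hN (Finset.mem_image_of_mem _ hj), rfl⟩
    have := comp_sigmaPart_mono hsub hS
    rw [sigmaPart, Finset.sum_map, Preadditive.comp_sum] at this
    refine this.symm.trans (Finset.sum_congr rfl fun j _ ↦ ?_)
    rw [Category.assoc]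
    congr! 2
    simp only [pr]
    congr!
  -- A map fixed by `s` has zero component at index 0, hence at every index by induction; finite
  -- support then makes it zero.
  have inj {Q : C} (hQ : compacts C Q) (z : Q ⟶ ∐ f) (hz : z ≫ (𝟙 _ - s) = 0) : z = 0 := by
    rw [Preadditive.comp_sub, Category.comp_id, sub_eq_zero] at hz
    have h (j : ℕ) : z ≫ pr j = 0 := by
      induction j with
      | zero => rw [hz, Category.assoc, s_pr_zero, comp_zero]
      | succ j ih => rw [hz, Category.assoc, s_pr_succ, ← Category.assoc, ih, zero_comp]
    obtain ⟨N, hN⟩ := supp hQ z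
    rw [hN]
    exact Finset.sum_eq_zero fun j _ ↦ by rw [h, zero_comp]
  obtain ⟨L, g, h, hT⟩ := distinguished_cocone_triangle (𝟙 (∐ f) - s)
  have hg : (𝟙 (∐ f) - s) ≫ g = 0 := dist_comp₁₂ hT
  have hg' : s ≫ g = g := by
    rw [Preadditive.sub_comp, Category.id_comp, sub_eq_zero] at hg
    exact hg.symm
  have hcomp (j l : ℕ) (h : j ≤ l) : X.map (homOfLE h) ≫ inc l ≫ g = inc j ≫ g := by
    induction l, h using Nat.le_induction with
    | base => exact (congrArg (· ≫ inc j ≫ g) (X.map_id j)).trans (Category.id_comp _)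
    | succ l hl ih =>
      rw [← ih, ← homOfLE_comp hl l.le_succ, X.map_comp]
      conv_rhs => rw [← hg', ← Category.assoc (inc l), inc_s]
      simp only [Category.assoc]
  refine ⟨L, fun j ↦ inc j ≫ g, ⟨hcomp, ?_, ?_, ?_, ?_⟩⟩
  · intro Q hQ q
    obtain ⟨y, hy⟩ := exists_unshift (q ≫ h)
    have hy0 : y ≫ (𝟙 _ - s) = 0 := (shiftFunctor C (1 : ℤ)).map_injective (by
      rw [← cancel_epi (shiftNegShift Q (1 : ℤ)).inv, Functor.map_comp, ← Category.assoc, ← hy,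
        Category.assoc, Functor.map_zero, comp_zero]
      rw [dist_comp₃₁ hT, comp_zero])
    rw [inj (compacts_shift hQ (-1)) y hy0, Functor.map_zero, comp_zero] at hy
    obtain ⟨z, hz⟩ := dist_lift₃ hT q hy
    obtain ⟨N, hN⟩ := supp hQ z
    refine ⟨N, ∑ j ∈ (Finset.range N).attach,
      (z ≫ pr j) ≫ X.map (homOfLE (Finset.mem_range.1 j.2).le), ?_⟩
    rw [← hz]
    conv_rhs => rw [hN]
    rw [Preadditive.sum_comp, Preadditive.sum_comp, ← Finset.sum_attach (Finset.range N)]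
    refine Finset.sum_congr rfl fun j _ ↦ ?_
    simp only [Category.assoc, hcomp]
  · intro Q hQ j y hy
    obtain ⟨z, hz⟩ := dist_lift₂ hT (y ≫ inc j) ((Category.assoc _ _ _).trans hy)
    obtain ⟨N, hN⟩ := supp hQ z
    refine ⟨j + N, by lia, ?_⟩
    -- Collapses the summands up to `j + N` onto the last one. It kills 1 - s on every summand of
    -- index below `N`, hence on `z`.
    let p : ∐ f ⟶ X.obj (j + N) := Sigma.desc fun l ↦
      if hl : l.down ≤ j + N then X.map (homOfLE hl) else 0
    have inc_p (l : ℕ) (hl : l ≤ j + N) : inc l ≫ p = X.map (homOfLE hl) :=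
      (Sigma.ι_desc _ _).trans (dif_pos hl)
    have hp : z ≫ (𝟙 (∐ f) - s) ≫ p = 0 := by
      rw [hN, Preadditive.sum_comp]
      refine Finset.sum_eq_zero fun l hl ↦ ?_
      rw [Finset.mem_range] at hl
      have : inc l ≫ (𝟙 (∐ f) - s) ≫ p = 0 := by
        rw [Preadditive.sub_comp, Preadditive.comp_sub, Category.id_comp, ← Category.assoc, inc_s,
          Category.assoc, inc_p _ (by lia), inc_p _ (by lia), ← X.map_comp, homOfLE_comp, sub_self]
      rw [Category.assoc, this, comp_zero]
    rw [← inc_p j (by lia), ← Category.assoc, ← hz, Category.assoc, hp]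
  · intro Y φ hφ
    let p : ∐ f ⟶ Y := Sigma.desc fun l ↦ φ l.down
    have inc_p (l : ℕ) : inc l ≫ p = φ l := Sigma.ι_desc _ _
    obtain ⟨a, ha⟩ := dist_desc₂ hT p (ext' _ _ fun j ↦ by
      rw [Preadditive.sub_comp, Preadditive.comp_sub, Category.id_comp, ← Category.assoc, inc_s,
          Category.assoc, inc_p, inc_p, hφ, sub_self, comp_zero])
    refine ⟨a, fun j ↦ ?_⟩
    rw [← inc_p, ← ha, Category.assoc]
  · intro Y h₀ h₁ a
    have hga : g ≫ a = 0 := ext' _ _ fun j ↦ by rw [h₀ j (_ ≫ _), comp_zero]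
    obtain ⟨b, hb⟩ := dist_desc₃ hT a hga
    have hb0 : b = 0 := (forall_shift_eq_zero_iff (m := -1) (by simp)).2 (fun c ↦
      ext' _ _ fun j ↦ by
        rw [(forall_shift_eq_zero_iff (n := 1) (by simp)).1 (h₁ j) (_ ≫ _), comp_zero]) b
    rw [← hb, hb0, comp_zero]

end Hocolim

/-! ### Elements of a cohomological functor and their extensions to larger compacts -/

section Pull

variable {C : Type u} [Category.{v} C] [Preadditive C] [HasZeroObject C] [HasShift C ℤ]
  [∀ n : ℤ, (shiftFunctor C n).Additive] [Pretriangulated C] [HasCoproducts.{v} C]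
  {k : Type w} [CommRing k] [Linear k C]

variable (H : (compacts C).FullSubcategoryᵒᵖ ⥤ ModuleCat.{v} k)

/-- The restriction of an element `x : H(Y)` along a morphism `f : X ⟶ Y` of compact objects. -/
def pull {X Y : (compacts C).FullSubcategory} (f : X.obj ⟶ Y.obj) (x : H.obj (op Y)) :
    H.obj (op X) :=
  (H.map (ObjectProperty.homMk f).op).hom x

variable {H}

lemma pull_id {X : (compacts C).FullSubcategory} (x : H.obj (op X)) : pull H (𝟙 X.obj) x = x :=
  DFunLike.congr_fun (congrArg ModuleCat.Hom.hom (H.map_id (op X))) x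

lemma pull_comp {X Y Z : (compacts C).FullSubcategory} (f : X.obj ⟶ Y.obj) (g : Y.obj ⟶ Z.obj)
    (x : H.obj (op Z)) : pull H (f ≫ g) x = pull H f (pull H g x) :=
  DFunLike.congr_fun (congrArg ModuleCat.Hom.hom
    (H.map_comp (ObjectProperty.homMk g).op (ObjectProperty.homMk f).op)) x

lemma pull_add' {X Y : (compacts C).FullSubcategory} (f : X.obj ⟶ Y.obj) (x y : H.obj (op Y)) :
    pull H f (x + y) = pull H f x + pull H f y := map_add _ _ _

lemma pull_sub' {X Y : (compacts C).FullSubcategory} (f : X.obj ⟶ Y.obj) (x y : H.obj (op Y)) :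
    pull H f (x - y) = pull H f x - pull H f y := map_sub _ _ _

lemma pull_zero' {X Y : (compacts C).FullSubcategory} (f : X.obj ⟶ Y.obj) :
    pull H f (0 : H.obj (op Y)) = 0 := map_zero _

variable (hH : IsCohomological k H)
include hH

lemma pull_add {X Y : (compacts C).FullSubcategory} (f g : X.obj ⟶ Y.obj) (x : H.obj (op Y)) :
    pull H (f + g) x = pull H f x + pull H g x := by
  have := hH.additive
  exact DFunLike.congr_fun (congrArg ModuleCat.Hom.hom (H.map_add
    (f := (ObjectProperty.homMk f : X ⟶ Y).op) (g := (ObjectProperty.homMk g : X ⟶ Y).op))) x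

lemma pull_smul {X Y : (compacts C).FullSubcategory} (r : k) (f : X.obj ⟶ Y.obj)
    (x : H.obj (op Y)) : pull H (r • f) x = r • pull H f x :=
  DFunLike.congr_fun (congrArg ModuleCat.Hom.hom
    (hH.map_smul r (ObjectProperty.homMk f : X ⟶ Y))) x

lemma pull_zero {X Y : (compacts C).FullSubcategory} (x : H.obj (op Y)) :
    pull H (0 : X.obj ⟶ Y.obj) x = 0 := by
  simpa using pull_smul hH 0 (0 : X.obj ⟶ Y.obj) x

lemma pull_sub {X Y : (compacts C).FullSubcategory} (f g : X.obj ⟶ Y.obj) (x : H.obj (op Y)) :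
    pull H (f - g) x = pull H f x - pull H g x := by
  rw [eq_sub_iff_add_eq, ← pull_add hH, sub_add_cancel]

lemma exists_pull_eq {X Y Z : (compacts C).FullSubcategory} {f : X.obj ⟶ Y.obj}
    {g : Y.obj ⟶ Z.obj} {h : Z.obj ⟶ X.obj⟦(1 : ℤ)⟧} (hT : Triangle.mk f g h ∈ distTriang C)
    (y : H.obj (op Y)) (hy : pull H f y = 0) : ∃ z : H.obj (op Z), pull H g z = y :=
  (hH.exact (ObjectProperty.homMk f : X ⟶ Y) (ObjectProperty.homMk g : Y ⟶ Z) h hT y).1 hy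

/-- The elements of `H(Q)` which are restrictions of `x : H(E)`. -/
def pullRange {E Q : (compacts C).FullSubcategory} (x : H.obj (op E)) :
    Submodule k (H.obj (op Q)) where
  carrier := {h | ∃ q : Q.obj ⟶ E.obj, pull H q x = h}
  zero_mem' := ⟨0, pull_zero hH x⟩
  add_mem' := by
    rintro _ _ ⟨a, rfl⟩ ⟨b, rfl⟩
    exact ⟨a + b, pull_add hH a b x⟩
  smul_mem' := by
    rintro r _ ⟨a, rfl⟩
    exact ⟨r • a, pull_smul hH r a x⟩

/-- The morphisms `Q ⟶ E` along which the restriction of `x : H(E)` vanishes. -/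
def pullKer {E Q : (compacts C).FullSubcategory} (x : H.obj (op E)) :
    Submodule k (Q.obj ⟶ E.obj) where
  carrier := {q | pull H q x = 0}
  zero_mem' := pull_zero hH x
  add_mem' := fun {a b} ha hb ↦ by
    change pull H (a + b) x = 0
    rw [pull_add hH, show pull H a x = 0 from ha, show pull H b x = 0 from hb, add_zero]
  smul_mem' := fun r a ha ↦ by
    change pull H (r • a) x = 0
    rw [pull_smul hH, show pull H a x = 0 from ha, smul_zero]

lemma exists_extension_mem {E Q : (compacts C).FullSubcategory} (x : H.obj (op E))
    (h : H.obj (op Q)) : ∃ (E' : (compacts C).FullSubcategory) (x' : H.obj (op E'))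
      (t : E.obj ⟶ E'.obj), pull H t x' = x ∧ h ∈ pullRange hH (Q := Q) x' := by
  let E' : (compacts C).FullSubcategory := ⟨E.obj ⊞ Q.obj, compacts_biprod E.2 Q.2⟩
  let x' : H.obj (op E') := pull H (X := E') (Y := E) (biprod.fst : E.obj ⊞ Q.obj ⟶ _) x +
    pull H (X := E') (Y := Q) (biprod.snd : E.obj ⊞ Q.obj ⟶ _) h
  refine ⟨E', x', biprod.inl, ?_, biprod.inr, ?_⟩
  · rw [pull_add', ← pull_comp, ← pull_comp, biprod.inl_fst, biprod.inl_snd, pull_id,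
      pull_zero hH, add_zero]
  · rw [pull_add', ← pull_comp, ← pull_comp, biprod.inr_fst, biprod.inr_snd, pull_id,
      pull_zero hH, zero_add]

lemma exists_extension_comp_eq_zero {E Q : (compacts C).FullSubcategory} (x : H.obj (op E))
    (q : Q.obj ⟶ E.obj) (hq : pull H q x = 0) :
    ∃ (E' : (compacts C).FullSubcategory) (x' : H.obj (op E'))
      (t : E.obj ⟶ E'.obj), pull H t x' = x ∧ q ≫ t = 0 := by
  obtain ⟨Z, g, h, hT⟩ := distinguished_cocone_triangle q
  let E' : (compacts C).FullSubcategory := ⟨Z, compacts_obj₃ hT Q.2 E.2⟩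
  obtain ⟨z, hz⟩ := exists_pull_eq hH (Z := E') hT x hq
  exact ⟨E', z, g, hz, dist_comp₁₂ hT⟩

lemma pullRange_le_of_extension {E E' Q : (compacts C).FullSubcategory} {x : H.obj (op E)}
    {x' : H.obj (op E')} {t : E.obj ⟶ E'.obj} (ht : pull H t x' = x) :
    pullRange hH (Q := Q) x ≤ pullRange hH x' := by
  rintro _ ⟨q, rfl⟩
  exact ⟨q ≫ t, by rw [pull_comp, ht]⟩

lemma exists_extension_subset {E Q : (compacts C).FullSubcategory} (x : H.obj (op E))
    (s : Finset (H.obj (op Q))) : ∃ (E' : (compacts C).FullSubcategory) (x' : H.obj (op E'))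
      (t : E.obj ⟶ E'.obj), pull H t x' = x ∧ ∀ h ∈ s, h ∈ pullRange hH (Q := Q) x' := by
  classical
  induction s using Finset.induction_on with
  | empty => exact ⟨E, x, 𝟙 _, pull_id x, by simp⟩
  | insert a s _ ih =>
    obtain ⟨E', x', t, ht, hs⟩ := ih
    obtain ⟨E'', x'', t', ht', ha⟩ := exists_extension_mem hH x' a
    refine ⟨E'', x'', t ≫ t', by rw [pull_comp, ht', ht], fun h hh ↦ ?_⟩
    obtain rfl | hh := Finset.mem_insert.1 hh
    · exact ha
    · exact pullRange_le_of_extension hH ht' (hs h hh)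

lemma exists_extension_comp_eq_zero_of_subset {E Q : (compacts C).FullSubcategory}
    (x : H.obj (op E)) (s : Finset (Q.obj ⟶ E.obj)) (hs : ∀ q ∈ s, pull H q x = 0) :
    ∃ (E' : (compacts C).FullSubcategory) (x' : H.obj (op E'))
      (t : E.obj ⟶ E'.obj), pull H t x' = x ∧ ∀ q ∈ s, q ≫ t = 0 := by
  classical
  induction s using Finset.induction_on with
  | empty => exact ⟨E, x, 𝟙 _, pull_id x, by simp⟩
  | insert a s _ ih =>
    obtain ⟨E', x', t, ht, hs'⟩ := ih fun q hq ↦ hs q (Finset.mem_insert_of_mem hq)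
    obtain ⟨E'', x'', t', ht', ha⟩ := exists_extension_comp_eq_zero hH x' (a ≫ t) (by
      rw [pull_comp, ht, hs a (Finset.mem_insert_self a s)])
    refine ⟨E'', x'', t ≫ t', by rw [pull_comp, ht', ht], fun h hh ↦ ?_⟩
    obtain rfl | hh := Finset.mem_insert.1 hh
    · rw [← Category.assoc, ha]
    · rw [← Category.assoc, hs' h hh, zero_comp]

variable [IsNoetherianRing k]
  (hfg : ∀ X : (compacts C).FullSubcategory, Module.Finite k (H.obj (op X)))
  (hhom : ∀ X Y : C, compacts C X → compacts C Y → Module.Finite k (X ⟶ Y))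
include hfg hhom

/-- Finitely many generators of H(Q) are hit after adding copies of Q to E. The kernel of Hom(Q, E')
→ H(Q) is then finitely generated by noetherianity, and its generators are killed by successive
cones, to which the element extends by exactness. -/
lemma exists_extension_single {E : (compacts C).FullSubcategory} (x : H.obj (op E))
    (Q : (compacts C).FullSubcategory) : ∃ (E' : (compacts C).FullSubcategory)
      (x' : H.obj (op E')) (t : E.obj ⟶ E'.obj), pull H t x' = x ∧
      (∀ h : H.obj (op Q), ∃ q : Q.obj ⟶ E'.obj, pull H q x' = h) ∧
      ∀ q : Q.obj ⟶ E.obj, pull H q x = 0 → q ≫ t = 0 := by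
  obtain ⟨s, hs⟩ := (hfg Q).fg_top
  obtain ⟨E', x', t, ht, hsurj⟩ := exists_extension_subset hH x s
  have := hhom _ _ Q.2 E'.2
  obtain ⟨r, hr⟩ := IsNoetherian.noetherian (pullKer hH (Q := Q) x')
  obtain ⟨E'', x'', t', ht', hker⟩ := exists_extension_comp_eq_zero_of_subset hH x' r
    fun q hq ↦ (hr ▸ Submodule.subset_span hq : q ∈ pullKer hH (Q := Q) x')
  refine ⟨E'', x'', t ≫ t', by rw [pull_comp, ht', ht], fun h ↦ ?_, fun q hq ↦ ?_⟩
  · have h1 : Submodule.span k (s : Set (H.obj (op Q))) ≤ pullRange hH x' :=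
      Submodule.span_le.2 hsurj
    exact pullRange_le_of_extension hH ht' (h1 (hs ▸ Submodule.mem_top))
  · have h2 : pullKer hH (Q := Q) x' ≤ LinearMap.ker (Linear.rightComp k Q.obj t') := by
      rw [← hr, Submodule.span_le]
      exact fun q hq ↦ hker q hq
    rw [← Category.assoc]
    refine h2 (x := q ≫ t) ?_
    change pull H (q ≫ t) x' = 0
    rw [pull_comp, ht, hq]

lemma exists_extension_of_finite {E : (compacts C).FullSubcategory} (x : H.obj (op E))
    {U : Set (compacts C).FullSubcategory} (hU : U.Finite) :
    ∃ (E' : (compacts C).FullSubcategory)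
      (x' : H.obj (op E')) (t : E.obj ⟶ E'.obj), pull H t x' = x ∧
      (∀ Q ∈ U, ∀ h : H.obj (op Q), ∃ q : Q.obj ⟶ E'.obj, pull H q x' = h) ∧
      ∀ Q ∈ U, ∀ q : Q.obj ⟶ E.obj, pull H q x = 0 → q ≫ t = 0 := by
  induction U, hU using Set.Finite.induction_on with
  | empty => exact ⟨E, x, 𝟙 _, pull_id x, by simp, by simp⟩
  | @insert a U _ _ ih =>
    obtain ⟨E', x', t, ht, hs, hk⟩ := ih
    obtain ⟨E'', x'', t', ht', hs', hk'⟩ := exists_extension_single hH hfg hhom x' a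
    refine ⟨E'', x'', t ≫ t', by rw [pull_comp, ht', ht], ?_, ?_⟩
    · rintro Q (rfl | hQ) h
      · exact hs' h
      · obtain ⟨q, hq⟩ := hs Q hQ h
        exact ⟨q ≫ t', by rw [pull_comp, ht', hq]⟩
    · rintro Q (rfl | hQ) q hq
      · rw [← Category.assoc]
        exact hk' _ (by rw [pull_comp, ht, hq])
      · rw [← Category.assoc, hk Q hQ q hq, zero_comp]

end Pull

/-! ### Dévissage along sums, extensions and retracts -/

section Devissage

variable {C : Type u} [Category.{v} C] [Preadditive C] [HasZeroObject C] [HasShift C ℤ]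
  [∀ n : ℤ, (shiftFunctor C n).Additive] [Pretriangulated C]

lemma prop_of_isColimit_cofan_of_ext {P : ObjectProperty C} (hzero : ∀ X, IsZero X → P X)
    (hext : ∀ T : Triangle C, T ∈ distTriang C → P T.obj₁ → P T.obj₃ → P T.obj₂)
    (hret : ∀ {X Y : C}, Retract X Y → P Y → P X) {n : ℕ} {Y : Fin n → C} {c : Cofan Y}
    (hc : IsColimit c) (hY : ∀ i, P (Y i)) : P c.pt := by
  have : P.IsStableUnderRetracts := ⟨hret⟩
  have : P.ContainsZero := ⟨_, isZero_zero C, hzero _ (isZero_zero C)⟩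
  have : P.IsClosedUnderBinaryCoproducts := ⟨by
    rintro X ⟨p⟩
    let e : p.diag.obj ⟨.left⟩ ⊞ p.diag.obj ⟨.right⟩ ≅ X :=
      (BinaryBiproduct.isColimit _ _).coconePointsIsoOfNatIso p.isColimit
        (diagramIsoPair p.diag).symm
    exact P.prop_of_iso e (hext _ (binaryBiproductTriangle_distinguished _ _)
      (p.prop_diag_obj _) (p.prop_diag_obj _))⟩
  have : P.IsClosedUnderFiniteCoproducts := ObjectProperty.IsClosedUnderFiniteCoproducts.mk'
  exact P.prop_of_isColimit_cofan hc hY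

lemma coprod_le_of_ext {U P : ObjectProperty C} (hzero : ∀ X, IsZero X → P X)
    (hext : ∀ T : Triangle C, T ∈ distTriang C → P T.obj₁ → P T.obj₃ → P T.obj₂)
    (hret : ∀ {X Y : C}, Retract X Y → P Y → P X) (hU : U ≤ P) {X : C} (hX : coprod U X) :
    P X := by
  induction hX with
  | of_mem X hX => exact hU X hX
  | sum n Y c hc _ ih => exact prop_of_isColimit_cofan_of_ext hzero hext hret hc ih
  | ext T hT _ _ h₁ h₃ => exact hext T hT h₁ h₃

lemma smallGen_le_of_ext {G : ℤ → ObjectProperty C} {s : Set ℤ} {P : ObjectProperty C}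
    (hzero : ∀ X, IsZero X → P X)
    (hext : ∀ T : Triangle C, T ∈ distTriang C → P T.obj₁ → P T.obj₃ → P T.obj₂)
    (hret : ∀ {X Y : C}, Retract X Y → P Y → P X) (hG : ∀ n ∈ s, G n ≤ P) :
    smallGen G s ≤ P := by
  rintro X ⟨Y, hY, ⟨r⟩⟩
  refine hret r (coprod_le_of_ext hzero hext hret ?_ hY)
  rintro Z ⟨n, hn, hZ⟩
  exact hG n hn Z hZ

end Devissage

/-! ### Sequences of compacts approximating a cohomological functor -/

section ApproxSeq

variable {C : Type u} [Category.{v} C] [Preadditive C] [HasZeroObject C] [HasShift C ℤ]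
  [∀ n : ℤ, (shiftFunctor C n).Additive] [Pretriangulated C] [HasCoproducts.{v} C]
  {k : Type w} [CommRing k] [Linear k C]

/-- A sequence of compact objects `X j` with compatible elements of `H (X j)`. -/
structure ApproxSeq (H : (compacts C).FullSubcategoryᵒᵖ ⥤ ModuleCat.{v} k) where
  /-- the sequence of compact objects -/
  X : ℕ ⥤ (compacts C).FullSubcategory
  /-- the elements -/
  x (j : ℕ) : H.obj (op (X.obj j))
  compat (j l : ℕ) (h : j ≤ l) : pull H (X.map (homOfLE h)).hom (x l) = x j

variable {H : (compacts C).FullSubcategoryᵒᵖ ⥤ ModuleCat.{v} k}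

namespace ApproxSeq

/-- The transition maps of the sequence. -/
def trans (S : ApproxSeq H) {j l : ℕ} (h : j ≤ l) : (S.X.obj j).obj ⟶ (S.X.obj l).obj :=
  (S.X.map (homOfLE h)).hom

lemma trans_trans (S : ApproxSeq H) {j l m : ℕ} (h : j ≤ l) (h' : l ≤ m) :
    S.trans h ≫ S.trans h' = S.trans (h.trans h') := by
  rw [trans, trans, trans, ← homOfLE_comp h h', S.X.map_comp]
  rfl

lemma pull_trans (S : ApproxSeq H) {j l : ℕ} (h : j ≤ l) : pull H (S.trans h) (S.x l) = S.x j :=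
  S.compat j l h

lemma pull_comp_trans (S : ApproxSeq H) {Q : (compacts C).FullSubcategory} {j l : ℕ} (h : j ≤ l)
    (q : Q.obj ⟶ (S.X.obj j).obj) : pull H (q ≫ S.trans h) (S.x l) = pull H q (S.x j) := by
  rw [pull_comp, S.pull_trans]

/-- Every element of `H(Q)` comes from a morphism to some term of the sequence. -/
def Surj (S : ApproxSeq H) (Q : C) : Prop :=
  ∀ (hQ : compacts C Q) (h : H.obj (op ⟨Q, hQ⟩)), ∃ (j : ℕ) (q : Q ⟶ (S.X.obj j).obj),
    pull H (X := ⟨Q, hQ⟩) q (S.x j) = h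

/-- Every morphism from `Q` to a term of the sequence which is zero in `H(Q)` vanishes
in some later term. -/
def Inj (S : ApproxSeq H) (Q : C) : Prop :=
  ∀ (hQ : compacts C Q) (j : ℕ) (q : Q ⟶ (S.X.obj j).obj),
    pull H (X := ⟨Q, hQ⟩) q (S.x j) = 0 → ∃ (l : ℕ) (h : j ≤ l), q ≫ S.trans h = 0

variable (S : ApproxSeq H)

lemma surj_of_retract {Q Q' : C} (r : Retract Q Q') (hQ' : compacts C Q') (h : S.Surj Q') :
    S.Surj Q := by
  intro hQ y
  obtain ⟨j, q, hq⟩ := h hQ' (pull H (X := ⟨Q', hQ'⟩) (Y := ⟨Q, hQ⟩) r.r y)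
  refine ⟨j, r.i ≫ q, ?_⟩
  rw [pull_comp (X := ⟨Q, hQ⟩) (Y := ⟨Q', hQ'⟩), hq, ← pull_comp (Z := ⟨Q, hQ⟩), r.retract]
  exact pull_id _

lemma inj_of_retract {Q Q' : C} (r : Retract Q Q') (hQ' : compacts C Q') (h : S.Inj Q') :
    S.Inj Q := by
  intro hQ j q hq
  obtain ⟨l, hl, e⟩ := h hQ' j (r.r ≫ q) (by
    rw [pull_comp (X := ⟨Q', hQ'⟩) (Y := ⟨Q, hQ⟩), hq, pull_zero'])
  refine ⟨l, hl, ?_⟩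
  have := congrArg (fun t ↦ r.i ≫ t) e
  simpa using this

variable (hH : IsCohomological k H)
include hH

/-- One half of the five lemma for the comparison colim Hom(-, X_j) → H. It uses injectivity at
Z⟦-1⟧, and `inj_obj₂` uses surjectivity at X⟦1⟧; this is why `Approximates` asks for all shifts at
once. -/
lemma surj_obj₂ {X Y Z : C} {f : X ⟶ Y} {g : Y ⟶ Z} {h : Z ⟶ X⟦(1 : ℤ)⟧}
    (hT : Triangle.mk f g h ∈ distTriang C) (hX : compacts C X) (hZ : compacts C Z)
    (sX : S.Surj X) (sZ : S.Surj Z) (iZ : S.Inj (Z⟦(-1 : ℤ)⟧)) : S.Surj Y := by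
  intro hY y
  let X' : (compacts C).FullSubcategory := ⟨X, hX⟩
  let Y' : (compacts C).FullSubcategory := ⟨Y, hY⟩
  let Z' : (compacts C).FullSubcategory := ⟨Z, hZ⟩
  let W' : (compacts C).FullSubcategory := ⟨Z⟦(-1 : ℤ)⟧, compacts_shift hZ _⟩
  have hT' := inv_rot_of_distTriang _ hT
  let w : Z⟦(-1 : ℤ)⟧ ⟶ X := (Triangle.mk f g h).invRotate.mor₁
  have hw : w ≫ f = 0 := comp_distTriang_mor_zero₁₂ _ hT'
  obtain ⟨j, p, hp⟩ := sX hX (pull H (X := X') (Y := Y') f y)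
  obtain ⟨l, hl, e⟩ := iZ W'.2 j (w ≫ p) (by
    rw [pull_comp (X := W') (Y := X'), hp, ← pull_comp (X := W') (Y := X') (Z := Y'), hw]
    exact pull_zero hH _)
  obtain ⟨q, hq⟩ : ∃ q : Y ⟶ (S.X.obj l).obj, f ≫ q = p ≫ S.trans hl := by
    obtain ⟨q, hq⟩ := Triangle.yoneda_exact₂ _ hT' (p ≫ S.trans hl) ((Category.assoc _ _ _).symm.trans e)
    exact ⟨q, hq.symm⟩
  obtain ⟨z, hz⟩ := exists_pull_eq hH (X := X') (Y := Y') (Z := Z') hT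
    (y - pull H (X := Y') q (S.x l)) (by
      rw [pull_sub', ← pull_comp (X := X') (Y := Y'), hq, S.pull_comp_trans (Q := X'), hp, sub_self])
  obtain ⟨m, r, hr⟩ := sZ hZ z
  refine ⟨max l m, q ≫ S.trans (le_max_left l m) + (g ≫ r) ≫ S.trans (le_max_right l m), ?_⟩
  rw [pull_add hH, S.pull_comp_trans (Q := Y'), S.pull_comp_trans (Q := Y'),
    pull_comp (X := Y') (Y := Z'), hr, hz, add_sub_cancel]

lemma inj_obj₂ {X Y Z : C} {f : X ⟶ Y} {g : Y ⟶ Z} {h : Z ⟶ X⟦(1 : ℤ)⟧}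
    (hT : Triangle.mk f g h ∈ distTriang C) (hX : compacts C X) (hZ : compacts C Z)
    (iX : S.Inj X) (iZ : S.Inj Z) (sX : S.Surj (X⟦(1 : ℤ)⟧)) : S.Inj Y := by
  intro hY j q hq
  let X' : (compacts C).FullSubcategory := ⟨X, hX⟩
  let Y' : (compacts C).FullSubcategory := ⟨Y, hY⟩
  let Z' : (compacts C).FullSubcategory := ⟨Z, hZ⟩
  let W' : (compacts C).FullSubcategory := ⟨X⟦(1 : ℤ)⟧, compacts_shift hX _⟩
  obtain ⟨l, hl, e⟩ := iX hX j (f ≫ q) (by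
    rw [pull_comp (X := X') (Y := Y'), hq, pull_zero'])
  obtain ⟨r, hr⟩ := dist_desc₂ hT (q ≫ S.trans hl) ((Category.assoc _ _ _).symm.trans e)
  obtain ⟨z, hz⟩ := exists_pull_eq hH (X := Y') (Y := Z') (Z := W') (rot_of_distTriang _ hT)
    (pull H (X := Z') r (S.x l)) (by
      change pull H (X := Y') (Y := Z') g _ = 0
      rw [← pull_comp (X := Y') (Y := Z'), hr, S.pull_comp_trans (Q := Y'), hq])
  change pull H (X := Z') (Y := W') h z = _ at hz
  obtain ⟨m, s, hs⟩ := sX W'.2 z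
  obtain ⟨n, hn, e'⟩ := iZ hZ (max l m)
    (r ≫ S.trans (le_max_left l m) - (h ≫ s) ≫ S.trans (le_max_right l m)) (by
      rw [pull_sub hH, S.pull_comp_trans (Q := Z'), S.pull_comp_trans (Q := Z'),
        pull_comp (X := Z') (Y := W'), hs, hz, sub_self])
  refine ⟨n, (hl.trans (le_max_left l m)).trans hn, ?_⟩
  have e'' := congrArg (fun t ↦ g ≫ t) e'
  simp only [Preadditive.sub_comp, Preadditive.comp_sub, Category.assoc, comp_zero] at e''
  rw [← Category.assoc g h, dist_comp₂₃ hT, zero_comp, sub_zero, ← Category.assoc, hr,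
    S.trans_trans, Category.assoc, S.trans_trans] at e''
  exact e''

/-- A sequence approximates `H` at `Q` if `H(Q⟦n⟧)` is the colimit of the groups of morphisms
from `Q⟦n⟧` to the terms of the sequence, for all `n`. -/
def Approximates (S : ApproxSeq H) (Q : C) : Prop :=
  compacts C Q ∧ ∀ n : ℤ, S.Surj (Q⟦n⟧) ∧ S.Inj (Q⟦n⟧)

lemma approximates_of_smallGen {G : ℤ → ObjectProperty C}
    (hG : ∀ n, G n ≤ S.Approximates) : smallGen G Set.univ ≤ S.Approximates := by
  have iso {Q Q' : C} (e : Q ≅ Q') (hQ : compacts C Q) : (S.Surj Q → S.Surj Q') ∧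
      (S.Inj Q → S.Inj Q') :=
    ⟨S.surj_of_retract (Retract.ofIso e.symm) hQ, S.inj_of_retract (Retract.ofIso e.symm) hQ⟩
  refine smallGen_le_of_ext ?_ ?_ ?_ (fun n _ ↦ hG n)
  · intro X hX
    refine ⟨compacts_of_isZero hX, fun n ↦ ⟨fun hQ y ↦ ⟨0, 0, ?_⟩, fun hQ j q _ ↦
      ⟨j, le_rfl, ((shiftFunctor C n).map_isZero hX).eq_of_src _ _⟩⟩⟩
    have : pull H (X := ⟨X⟦n⟧, hQ⟩) (𝟙 (X⟦n⟧)) y = pull H (X := ⟨X⟦n⟧, hQ⟩) (0 : X⟦n⟧ ⟶ X⟦n⟧) y :=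
      congrArg (pull H (X := ⟨X⟦n⟧, hQ⟩) (Y := ⟨X⟦n⟧, hQ⟩) · y)
        (((shiftFunctor C n).map_isZero hX).eq_of_src _ _)
    refine (pull_zero hH _).trans ((pull_zero hH _).symm.trans (this.symm.trans (pull_id _)))
  · rintro T hT ⟨c₁, h₁⟩ ⟨c₃, h₃⟩
    refine ⟨compacts_obj₂ hT c₁ c₃, fun n ↦ ?_⟩
    have hTn := Triangle.shift_distinguished T hT n
    have e₁ : T.obj₁⟦n + 1⟧ ≅ T.obj₁⟦n⟧⟦(1 : ℤ)⟧ := (shiftFunctorAdd C n 1).app _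
    have e₃ : T.obj₃⟦n + -1⟧ ≅ T.obj₃⟦n⟧⟦(-1 : ℤ)⟧ := (shiftFunctorAdd C n (-1)).app _
    exact ⟨S.surj_obj₂ hH hTn (compacts_shift c₁ n) (compacts_shift c₃ n) (h₁ n).1 (h₃ n).1
        ((iso e₃ (compacts_shift c₃ _)).2 (h₃ _).2),
      S.inj_obj₂ hH hTn (compacts_shift c₁ n) (compacts_shift c₃ n) (h₁ n).2 (h₃ n).2
        ((iso e₁ (compacts_shift c₁ _)).1 (h₁ _).1)⟩
  · rintro X Y r ⟨c, h⟩
    exact ⟨compacts_of_retract r c, fun n ↦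
      ⟨S.surj_of_retract (r.map (shiftFunctor C n)) (compacts_shift c n) (h n).1,
        S.inj_of_retract (r.map (shiftFunctor C n)) (compacts_shift c n) (h n).2⟩⟩

end ApproxSeq

end ApproxSeq

/-! ### Constructing the sequence and representing a cohomological functor -/

section Representability

variable {C : Type u} [Category.{v} C] [Preadditive C] [HasZeroObject C] [HasShift C ℤ]
  [∀ n : ℤ, (shiftFunctor C n).Additive] [Pretriangulated C] [HasCoproducts.{v} C]
  {k : Type w} [CommRing k] [Linear k C]

/-- The shifts `Z⟦t⟧` of the objects `Z` of `G n`, where `|n|` and `|t|` are at most `j`. -/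
def shiftedUnion (G : ℤ → ObjectProperty C) (j : ℕ) : Set (compacts C).FullSubcategory :=
  {Q | ∃ n ∈ Set.Icc (-(j : ℤ)) j, ∃ t ∈ Set.Icc (-(j : ℤ)) j, ∃ Z : C, G n Z ∧ Q.obj = Z⟦t⟧}

lemma finite_setOf_obj_mem {P : ObjectProperty C} {V : Set C} (hV : V.Finite) :
    {Q : P.FullSubcategory | Q.obj ∈ V}.Finite :=
  hV.preimage (f := fun Q : P.FullSubcategory ↦ Q.obj) fun _ _ _ _ h ↦
    ObjectProperty.FullSubcategory.ext h

lemma finite_shiftedUnion {G : ℤ → ObjectProperty C} (hG : ∀ n, Set.Finite {X : C | G n X})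
    (j : ℕ) : (shiftedUnion G j).Finite := by
  have hV : (⋃ n ∈ Set.Icc (-(j : ℤ)) j, ⋃ t ∈ Set.Icc (-(j : ℤ)) j,
      (fun Z : C ↦ Z⟦t⟧) '' {X : C | G n X}).Finite :=
    (Set.finite_Icc _ _).biUnion fun n _ ↦ (Set.finite_Icc _ _).biUnion fun t _ ↦ (hG n).image _
  refine (finite_setOf_obj_mem (P := compacts C) hV).subset ?_
  rintro Q ⟨n, hn, t, ht, Z, hZ, e⟩
  simp only [Set.mem_ofPred_eq, Set.mem_iUnion]
  exact ⟨n, hn, t, ht, Z, hZ, e.symm⟩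

/-- The sequence given by its terms and the maps from each term to the next one. -/
def ApproxSeq.ofSequence {H : (compacts C).FullSubcategoryᵒᵖ ⥤ ModuleCat.{v} k}
    (E : ℕ → (compacts C).FullSubcategory) (x : ∀ j, H.obj (op (E j)))
    (t : ∀ j, (E j).obj ⟶ (E (j + 1)).obj) (ht : ∀ j, pull H (t j) (x (j + 1)) = x j) :
    ApproxSeq H where
  X := Functor.ofSequence (X := E) fun j ↦ ObjectProperty.homMk (t j)
  x := x
  compat j l h := by
    let X := Functor.ofSequence (X := E) fun j ↦ ObjectProperty.homMk (t j)
    change pull H (X := E j) (Y := E l) (X.map (homOfLE h)).hom (x l) = x j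
    induction l, h using Nat.le_induction with
    | base =>
      exact (congrArg (fun f : E j ⟶ E j ↦ pull H f.hom (x j)) (X.map_id j)).trans (pull_id _)
    | succ l hl ih =>
      have h1 : (X.map (homOfLE (hl.trans l.le_succ))).hom = (X.map (homOfLE hl)).hom ≫ t l := by
        rw [← homOfLE_comp hl l.le_succ, X.map_comp]
        exact congrArg (fun f : X.obj l ⟶ X.obj (l + 1) ↦ (X.map (homOfLE hl)).hom ≫ f.hom)
          (Functor.ofSequence_map_homOfLE_succ _ l)
      exact (congrArg (fun f ↦ pull H (X := E j) (Y := E (l + 1)) f (x (l + 1))) h1).trans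
        ((pull_comp (X := E j) (Y := E l) _ _ _).trans ((congrArg _ (ht l)).trans ih))

/-- Stage j treats the finite set `shiftedUnion G j`; these sets exhaust all shifts of all
generators, and dévissage passes to all compacts. The property `P` is imposed by enlarging once more
at the end of each stage, which preserves what was achieved. -/
lemma exists_approxSeq [IsNoetherianRing k]
    {H : (compacts C).FullSubcategoryᵒᵖ ⥤ ModuleCat.{v} k} (hH : IsCohomological k H)
    (hfg : ∀ X : (compacts C).FullSubcategory, Module.Finite k (H.obj (op X)))
    (hhom : ∀ X Y : C, compacts C X → compacts C Y → Module.Finite k (X ⟶ Y))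
    {G : ℤ → ObjectProperty C} (hG : IsFiniteGeneratingSequence G) (P : ObjectProperty C)
    (hP : ∀ (E : (compacts C).FullSubcategory) (x : H.obj (op E)),
      ∃ (E' : (compacts C).FullSubcategory) (x' : H.obj (op E')) (t : E.obj ⟶ E'.obj),
        pull H t x' = x ∧ P E'.obj) :
    ∃ S : ApproxSeq H, (∀ j, P (S.X.obj j).obj) ∧ compacts C ≤ S.Approximates := by
  have step : ∀ (j : ℕ) (s : Σ E : (compacts C).FullSubcategory, H.obj (op E)),
      ∃ (s' : Σ E : (compacts C).FullSubcategory, H.obj (op E)) (t : s.1.obj ⟶ s'.1.obj),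
        pull H t s'.2 = s.2 ∧ P s'.1.obj ∧
        (∀ Q ∈ shiftedUnion G j, ∀ h : H.obj (op Q), ∃ q : Q.obj ⟶ s'.1.obj, pull H q s'.2 = h) ∧
        ∀ Q ∈ shiftedUnion G j, ∀ q : Q.obj ⟶ s.1.obj, pull H q s.2 = 0 → q ≫ t = 0 := by
    rintro j ⟨E, x⟩
    obtain ⟨E', x', t, ht, hs, hk⟩ := exists_extension_of_finite hH hfg hhom x
      (finite_shiftedUnion hG.finite j)
    obtain ⟨E'', x'', t', ht', hE⟩ := hP E' x'
    refine ⟨⟨E'', x''⟩, t ≫ t', ?_, hE, fun Q hQ h ↦ ?_, fun Q hQ q hq ↦ ?_⟩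
    · rw [pull_comp, ht', ht]
    · obtain ⟨q, hq⟩ := hs Q hQ h
      exact ⟨q ≫ t', by rw [pull_comp, ht', hq]⟩
    · rw [← Category.assoc, hk Q hQ q hq, zero_comp]
  choose next t ht hPn hsurj hker using step
  obtain ⟨E₀, x₀, _, -, hE₀⟩ := hP ⟨_, compacts_of_isZero (isZero_zero C)⟩ 0
  let seq : ℕ → Σ E : (compacts C).FullSubcategory, H.obj (op E) :=
    fun j ↦ Nat.rec ⟨E₀, x₀⟩ (fun j s ↦ next j s) j
  let S : ApproxSeq H := ApproxSeq.ofSequence (fun j ↦ (seq j).1) (fun j ↦ (seq j).2)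
    (fun j ↦ t j (seq j)) (fun j ↦ ht j (seq j))
  have hS (j : ℕ) : S.trans j.le_succ = t j (seq j) :=
    congrArg InducedCategory.Hom.hom (Functor.ofSequence_map_homOfLE_succ _ j)
  refine ⟨S, fun j ↦ ?_, ?_⟩
  · cases j with
    | zero => exact hE₀
    | succ j => exact hPn j (seq j)
  · rw [← hG.generates]
    refine S.approximates_of_smallGen hH fun n Z hZ ↦ ⟨hG.le_compacts n Z hZ, fun m ↦ ⟨?_, ?_⟩⟩
    · intro hQ h
      obtain ⟨q, hq⟩ := hsurj (n.natAbs + m.natAbs) (seq _) ⟨Z⟦m⟧, hQ⟩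
        ⟨n, by constructor <;> push_cast <;> grind, m, by constructor <;> push_cast <;> grind,
          Z, hZ, rfl⟩ h
      exact ⟨n.natAbs + m.natAbs + 1, q, hq⟩
    · intro hQ j q hq
      -- The relation is first moved to a stage whose finite set contains `Z⟦m⟧`; the next
      -- transition map then kills it.
      have hjl : j ≤ j + n.natAbs + m.natAbs := by lia
      refine ⟨j + n.natAbs + m.natAbs + 1, by lia, ?_⟩
      rw [← S.trans_trans hjl (Nat.le_succ _), ← Category.assoc, hS]
      refine hker _ (seq _) ⟨Z⟦m⟧, hQ⟩ ⟨n, by constructor <;> push_cast <;> grind, m, by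
        constructor <;> push_cast <;> grind, Z, hZ, rfl⟩ _ ?_
      exact (S.pull_comp_trans (Q := ⟨Z⟦m⟧, hQ⟩) hjl q).trans hq

/-- Compacts are stable under shifts, so the hypotheses force every map from a compact to the cone
of `f` to vanish. -/
lemma isIso_of_bijective_on_compacts (hC : IsCompactlyGenerated C) {L F : C} (f : L ⟶ F)
    (hs : ∀ Q, compacts C Q → ∀ q : Q ⟶ F, ∃ p : Q ⟶ L, p ≫ f = q)
    (hi : ∀ Q, compacts C Q → ∀ p : Q ⟶ L, p ≫ f = 0 → p = 0) : IsIso f := by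
  obtain ⟨Z, g, h, hT⟩ := distinguished_cocone_triangle f
  obtain ⟨S, -, hS, hZ⟩ := hC
  refine (Triangle.isZero₃_iff_isIso₁ _ hT).1 (hZ Z fun X hX n q ↦ ?_)
  have hQ := compacts_shift (hS X hX) n
  obtain ⟨y, hy⟩ := exists_unshift (q ≫ h)
  have hy0 : y = 0 := hi _ (compacts_shift hQ (-1)) y
    ((shiftFunctor C (1 : ℤ)).map_injective (by
      rw [← cancel_epi (shiftNegShift (X⟦n⟧) (1 : ℤ)).inv, Functor.map_comp, ← Category.assoc,
        ← hy, Category.assoc, Functor.map_zero, comp_zero, dist_comp₃₁ hT, comp_zero]))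
  rw [hy0, Functor.map_zero, comp_zero] at hy
  obtain ⟨p, rfl⟩ := dist_lift₃ hT q hy
  obtain ⟨p', rfl⟩ := hs _ hQ p
  rw [Category.assoc, dist_comp₁₂ hT, comp_zero]

variable (k) in
/-- The functor `Hom(-, F)` on the compact objects. -/
abbrev yonedaCompacts (F : C) : (compacts C).FullSubcategoryᵒᵖ ⥤ ModuleCat.{v} k :=
  (compacts C).ι.op ⋙ (linearYoneda k C).obj F

lemma isCohomological_yonedaCompacts (F : C) : IsCohomological k (yonedaCompacts k F) where
  additive := inferInstance
  map_smul r f := by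
    ext (x : _ ⟶ F)
    exact Linear.smul_comp _ _ _ r f.hom x
  exact {X Y Z} f g h hT := by
    intro (y : Y.obj ⟶ F)
    constructor
    · intro hy
      exact dist_desc₂ hT y hy
    · rintro ⟨z : Z.obj ⟶ F, rfl⟩
      change f.hom ≫ g.hom ≫ z = 0
      rw [← Category.assoc, dist_comp₁₂ hT, zero_comp]

/-- Maps from a compact to `L` come from maps to terms, uniquely up to passing to a later term.
Pulling back the elements `S.x j` along them gives the comparison map, and `Surj` and `Inj` say that
it is bijective. -/
lemma exists_iso_of_isHocolim {H : (compacts C).FullSubcategoryᵒᵖ ⥤ ModuleCat.{v} k}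
    (hH : IsCohomological k H) (S : ApproxSeq H) (hS : compacts C ≤ S.Approximates) {L : C}
    {i : ∀ j, (S.X.obj j).obj ⟶ L} (hL : IsHocolim (S.X ⋙ (compacts C).ι) L i) :
    Nonempty (yonedaCompacts k L ≅ H) := by
  have hSI (Q : C) (hQ : compacts C Q) : S.Surj Q ∧ S.Inj Q := by
    have e : Q⟦(0 : ℤ)⟧ ≅ Q := (shiftFunctorZero C ℤ).app Q
    exact ⟨S.surj_of_retract (Retract.ofIso e.symm) (compacts_shift hQ 0) ((hS Q hQ).2 0).1,
      S.inj_of_retract (Retract.ofIso e.symm) (compacts_shift hQ 0) ((hS Q hQ).2 0).2⟩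
  have hi {j l : ℕ} (h : j ≤ l) : S.trans h ≫ i l = i j := hL.comp j l h
  have uniq (Q : (compacts C).FullSubcategory) {j l : ℕ} (y : Q.obj ⟶ (S.X.obj j).obj)
      (z : Q.obj ⟶ (S.X.obj l).obj) (h : y ≫ i j = z ≫ i l) :
      pull H y (S.x j) = pull H z (S.x l) := by
    obtain ⟨m, hm, e⟩ := hL.exists_eq_zero Q.obj Q.2 (max j l)
      (y ≫ S.trans (le_max_left j l) - z ≫ S.trans (le_max_right j l)) (by
        refine (Preadditive.sub_comp _ _ _).trans ?_
        rw [Category.assoc, Category.assoc, hi, hi, h, sub_self])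
    have e' : (y ≫ S.trans (le_max_left j l) - z ≫ S.trans (le_max_right j l)) ≫ S.trans hm = 0 := e
    have h0 := S.pull_comp_trans hm
      (y ≫ S.trans (le_max_left j l) - z ≫ S.trans (le_max_right j l))
    rw [e', pull_zero hH, pull_sub hH, S.pull_comp_trans, S.pull_comp_trans] at h0
    exact sub_eq_zero.1 h0.symm
  have lift (Q : (compacts C).FullSubcategory) (q : Q.obj ⟶ L) :
      ∃ v : H.obj (op Q), ∀ (j : ℕ) (y : Q.obj ⟶ (S.X.obj j).obj), y ≫ i j = q →
        pull H y (S.x j) = v := by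
    obtain ⟨j, y, hy⟩ := hL.exists_lift Q.obj Q.2 q
    exact ⟨pull H y (S.x j), fun l z hz ↦ uniq Q z y (hz.trans hy.symm)⟩
  choose θ hθ using lift
  have hlin (Q : (compacts C).FullSubcategory) (q q' : Q.obj ⟶ L) (r : k) :
      θ Q (r • q + q') = r • θ Q q + θ Q q' := by
    obtain ⟨j, y, hy⟩ := hL.exists_lift Q.obj Q.2 q
    obtain ⟨l, z, hz⟩ := hL.exists_lift Q.obj Q.2 q'
    rw [← hθ Q q j y hy, ← hθ Q q' l z hz, ← S.pull_comp_trans (le_max_left j l) y,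
      ← S.pull_comp_trans (le_max_right j l) z, ← pull_smul hH, ← pull_add hH]
    refine (hθ Q _ (max j l) _ ?_).symm
    refine (Preadditive.add_comp _ _ _ _ _ _).trans ?_
    rw [Linear.smul_comp, Category.assoc, Category.assoc, hi, hi]
    exact congrArg₂ _ (congrArg _ hy) hz
  let Θ (Q : (compacts C).FullSubcategory) : (Q.obj ⟶ L) →ₗ[k] H.obj (op Q) :=
    { toFun := θ Q
      map_add' := fun a b ↦ by simpa using hlin Q a b 1
      map_smul' := fun r a ↦ by
        have h0 : θ Q 0 = 0 := by simpa using hlin Q 0 0 1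
        simpa [h0] using hlin Q a 0 r }
  have hbij (Q : (compacts C).FullSubcategory) : Function.Bijective (Θ Q) := by
    refine ⟨(injective_iff_map_eq_zero (Θ Q)).2 fun q hq ↦ ?_, fun v ↦ ?_⟩
    · obtain ⟨j, y, hy⟩ := hL.exists_lift Q.obj Q.2 q
      obtain ⟨l, hl, e⟩ := (hSI Q.obj Q.2).2 Q.2 j y ((hθ Q q j y hy).trans hq)
      rw [← hy]
      change y ≫ i j = 0
      rw [← hi hl, ← Category.assoc, e, zero_comp]
    · obtain ⟨j, y, hy⟩ := (hSI Q.obj Q.2).1 Q.2 v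
      exact ⟨y ≫ i j, ((hθ Q _ j y rfl).symm.trans hy)⟩
  refine ⟨NatIso.ofComponents
    (fun Q ↦ (LinearEquiv.ofBijective (Θ Q.unop) (hbij Q.unop)).toModuleIso) ?_⟩
  intro Q Q' f
  ext (q : Q.unop.obj ⟶ L)
  change θ Q'.unop (f.unop.hom ≫ q) = pull H f.unop.hom (θ Q.unop q)
  obtain ⟨j, y, hy⟩ := hL.exists_lift Q.unop.obj Q.unop.2 q
  rw [← hθ Q.unop q j y hy, ← pull_comp]
  exact (hθ Q'.unop _ j _ ((Category.assoc _ _ _).trans (congrArg _ hy))).symm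

end Representability

/-! ### Objects with finitely generated Hom from compacts -/

section HomFinite

variable {C : Type u} [Category.{v} C] [Preadditive C] [HasZeroObject C] [HasShift C ℤ]
  [∀ n : ℤ, (shiftFunctor C n).Additive] [Pretriangulated C] [HasCoproducts.{v} C]
  (k : Type w) [CommRing k] [Linear k C]

/-- The module of morphisms from any compact object to `F` is finitely generated. -/
def HomFinite : ObjectProperty C :=
  fun F ↦ ∀ X : C, compacts C X → Module.Finite k (X ⟶ F)

lemma finite_of_exact [IsNoetherianRing k] {A B D : Type*} [AddCommGroup A] [AddCommGroup B]
    [AddCommGroup D] [Module k A] [Module k B] [Module k D] [Module.Finite k A]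
    [Module.Finite k D] (f : A →ₗ[k] B) (g : B →ₗ[k] D) (h : ∀ b, g b = 0 → ∃ a, f a = b)
    (h' : ∀ a, g (f a) = 0) : Module.Finite k B := by
  have := isNoetherian_of_range_eq_ker f g (by
    ext b
    refine ⟨?_, h b⟩
    rintro ⟨a, rfl⟩
    exact h' a)
  infer_instance

variable {k}

lemma HomFinite.obj₂ [IsNoetherianRing k] {X Y Z : C} {f : X ⟶ Y} {g : Y ⟶ Z}
    {h : Z ⟶ X⟦(1 : ℤ)⟧} (hT : Triangle.mk f g h ∈ distTriang C) (hX : HomFinite k X)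
    (hZ : HomFinite k Z) : HomFinite k Y := by
  intro Q hQ
  have := hX Q hQ
  have := hZ Q hQ
  exact finite_of_exact k (Linear.rightComp k Q f) (Linear.rightComp k Q g)
    (fun b hb ↦ dist_lift₂ hT b hb) (fun a ↦ by
      change (a ≫ f) ≫ g = 0
      rw [Category.assoc, dist_comp₁₂ hT, comp_zero])

lemma HomFinite.of_retract {X Y : C} (r : Retract X Y) (hY : HomFinite k Y) : HomFinite k X := by
  intro Q hQ
  have := hY Q hQ
  exact Module.Finite.of_surjective (Linear.rightComp k Q r.r) fun q ↦ ⟨q ≫ r.i, by simp⟩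

lemma HomFinite.shift [∀ n : ℤ, (shiftFunctor C n).Linear k] {X : C} (hX : HomFinite k X)
    (n : ℤ) : HomFinite k (X⟦n⟧) := by
  intro Q hQ
  have := hX (Q⟦-n⟧) (compacts_shift hQ (-n))
  refine Module.Finite.of_surjective ((Linear.leftComp k (X⟦n⟧) (shiftNegShift Q n).inv).comp
    ((shiftFunctor C n).mapLinearMap k (X := Q⟦-n⟧) (Y := X))) fun q ↦
      ⟨(shiftFunctor C n).preimage ((shiftNegShift Q n).hom ≫ q), ?_⟩
  change (shiftNegShift Q n).inv ≫ (shiftFunctor C n).map ((shiftFunctor C n).preimage _) = q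
  simp

lemma HomFinite.biprod [IsNoetherianRing k] {X Y : C} (hX : HomFinite k X) (hY : HomFinite k Y) :
    HomFinite k (X ⊞ Y) :=
  HomFinite.obj₂ (binaryBiproductTriangle_distinguished X Y) hX hY

lemma homFinite_of_compacts [IsNoetherianRing k] {G : ℤ → ObjectProperty C}
    (hG : IsGeneratingSequence G)
    (hfin : ∀ (m n : ℤ) (X Y : C), G m X → G n Y → Module.Finite k (X ⟶ Y)) :
    compacts C ≤ HomFinite k := by
  have key (Y : C) (hY : ∀ n X, G n X → Module.Finite k (X ⟶ Y)) : HomFinite k Y := by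
    intro X hX
    rw [← hG.generates] at hX
    refine smallGen_le_of_ext (P := fun X ↦ Module.Finite k (X ⟶ Y)) ?_ ?_ ?_
      (fun n _ X hX ↦ hY n X hX) X hX
    · intro X hX
      have : Subsingleton (X ⟶ Y) := ⟨fun _ _ ↦ hX.eq_of_src _ _⟩
      infer_instance
    · intro T hT h₁ h₃
      exact finite_of_exact k (Linear.leftComp k Y T.mor₂) (Linear.leftComp k Y T.mor₁)
        (fun b hb ↦ dist_desc₂ hT b hb) (fun a ↦ by
          change T.mor₁ ≫ T.mor₂ ≫ a = 0
          rw [← Category.assoc, comp_distTriang_mor_zero₁₂ _ hT, zero_comp])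
    · intro X X' r h
      exact Module.Finite.of_surjective (Linear.leftComp k Y r.i) fun q ↦ ⟨r.r ≫ q, by simp⟩
  rw [← hG.generates]
  refine smallGen_le_of_ext ?_ ?_ ?_ (fun n _ Y hY ↦ key Y fun m X hX ↦ hfin m n X Y hX hY)
  · intro Y hY X _
    have : Subsingleton (X ⟶ Y) := ⟨fun _ _ ↦ hY.eq_of_tgt _ _⟩
    infer_instance
  · exact fun T hT h₁ h₃ ↦ HomFinite.obj₂ hT h₁ h₃
  · exact fun r h ↦ h.of_retract r

lemma IsHocolim.of_iso {X : ℕ ⥤ C} {L F : C} {i : ∀ j, X.obj j ⟶ L} (h : IsHocolim X L i)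
    (f : L ⟶ F) [IsIso f] {x : ∀ j, X.obj j ⟶ F} (hx : ∀ j, i j ≫ f = x j) : IsHocolim X F x where
  comp j l hjl := by rw [← hx, ← hx, ← h.comp j l hjl, Category.assoc]
  exists_lift Q hQ q := by
    obtain ⟨j, y, hy⟩ := h.exists_lift Q hQ (q ≫ inv f)
    exact ⟨j, y, by rw [← hx, ← Category.assoc, hy, Category.assoc, IsIso.inv_hom_id,
      Category.comp_id]⟩
  exists_eq_zero Q hQ j y hy := h.exists_eq_zero Q hQ j y (by
    rw [← cancel_mono f, Category.assoc, hx, hy, zero_comp])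
  exists_desc Y φ hφ := by
    obtain ⟨a, ha⟩ := h.exists_desc Y φ hφ
    exact ⟨inv f ≫ a, fun j ↦ by rw [← hx, Category.assoc, IsIso.hom_inv_id_assoc, ha]⟩
  eq_zero Y h₀ h₁ a := by
    rw [← cancel_epi f, h.eq_zero Y h₀ h₁ (f ≫ a), comp_zero]

variable [IsNoetherianRing k]

/-- The approximating sequence of Hom(-, F) consists of compacts over F; the induced map from its
homotopy colimit to F is bijective on maps from compacts, hence invertible. -/
lemma exists_isHocolim_of_homFinite (hC : IsCompactlyGenerated C)
    {G : ℤ → ObjectProperty C} (hG : IsFiniteGeneratingSequence G)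
    (hhom : compacts C ≤ HomFinite k) {F : C} (hF : HomFinite k F)
    (P : ObjectProperty C)
    (hP : ∀ (E : C) (x : E ⟶ F), compacts C E →
      ∃ (E' : C) (x' : E' ⟶ F) (t : E ⟶ E'), t ≫ x' = x ∧ compacts C E' ∧ P E') :
    ∃ (X : ℕ ⥤ C) (x : ∀ j, X.obj j ⟶ F), IsHocolim X F x ∧ ∀ j, compacts C (X.obj j) ∧
      P (X.obj j) := by
  obtain ⟨S, hS, hS'⟩ := exists_approxSeq (isCohomological_yonedaCompacts (k := k) F)
    (fun X ↦ hF _ X.2) (fun X Y hX hY ↦ hhom Y hY X hX) hG P (fun E x ↦ by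
      obtain ⟨E', x', t, ht, h1, h2⟩ := hP E.obj x E.2
      exact ⟨⟨E', h1⟩, x', t, ht, h2⟩)
  obtain ⟨L, i, hL⟩ := exists_isHocolim (S.X ⋙ (compacts C).ι)
  let x (j : ℕ) : (S.X.obj j).obj ⟶ F := S.x j
  obtain ⟨f, hf⟩ := hL.exists_desc F x fun j ↦ S.pull_trans j.le_succ
  have hfx (j : ℕ) {Q : C} (y : Q ⟶ (S.X.obj j).obj) : (y ≫ i j) ≫ f = y ≫ x j := by
    rw [Category.assoc]
    exact congrArg _ (hf j)
  have hSI (Q : C) (hQ : compacts C Q) : S.Surj Q ∧ S.Inj Q := by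
    have e : Q⟦(0 : ℤ)⟧ ≅ Q := (shiftFunctorZero C ℤ).app Q
    exact ⟨S.surj_of_retract (Retract.ofIso e.symm) (compacts_shift hQ 0) ((hS' Q hQ).2 0).1,
      S.inj_of_retract (Retract.ofIso e.symm) (compacts_shift hQ 0) ((hS' Q hQ).2 0).2⟩
  have : IsIso f := isIso_of_bijective_on_compacts hC f (fun Q hQ q ↦ by
      obtain ⟨j, y, hy⟩ := (hSI Q hQ).1 hQ q
      exact ⟨y ≫ i j, (hfx j y).trans hy⟩) (fun Q hQ p hp ↦ by
      obtain ⟨j, y, rfl⟩ := hL.exists_lift Q hQ p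
      obtain ⟨l, hl, e⟩ := (hSI Q hQ).2 hQ j y ((hfx j y).symm.trans hp)
      have h1 : S.trans hl ≫ i l = i j := hL.comp j l hl
      exact (congrArg (y ≫ ·) h1).symm.trans
        ((Category.assoc _ _ _).symm.trans ((congrArg (· ≫ i l) e).trans zero_comp)))
  exact ⟨S.X ⋙ (compacts C).ι, x, hL.of_iso f hf, fun j ↦ ⟨(S.X.obj j).2, hS j⟩⟩

lemma exists_map_eq_of_isHocolim {F F' : C} {X : ℕ ⥤ C} {x : ∀ j, X.obj j ⟶ F}
    (hF : IsHocolim X F x) (hX : ∀ j, compacts C (X.obj j))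
    (η : yonedaCompacts k F ⟶ yonedaCompacts k F') :
    ∃ f : F ⟶ F', Functor.whiskerLeft (compacts C).ι.op ((linearYoneda k C).map f) = η := by
  let a (Q : C) (hQ : compacts C Q) (q : Q ⟶ F) : Q ⟶ F' := (η.app (op ⟨Q, hQ⟩)).hom q
  have ha {Q Q' : C} (hQ : compacts C Q) (hQ' : compacts C Q') (g : Q' ⟶ Q) (q : Q ⟶ F) :
      a Q' hQ' (g ≫ q) = g ≫ a Q hQ q :=
    DFunLike.congr_fun (congrArg ModuleCat.Hom.hom (η.naturality
      (ObjectProperty.homMk g : (⟨Q', hQ'⟩ : (compacts C).FullSubcategory) ⟶ ⟨Q, hQ⟩).op)) q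
  obtain ⟨f, hf⟩ := hF.exists_desc F' (fun j ↦ a _ (hX j) (x j)) fun j ↦ by
    rw [← ha, hF.comp]
  refine ⟨f, ?_⟩
  ext Q (q : Q.unop.obj ⟶ F)
  change q ≫ f = a Q.unop.obj Q.unop.2 q
  obtain ⟨j, y, rfl⟩ := hF.exists_lift _ Q.unop.2 q
  rw [ha (hX j), ← hf, Category.assoc]

end HomFinite

/-! ### The metrics M^G and R^G, their shifts and vanishing of Hom -/

section Metrics

variable {C : Type u} [Category.{v} C] [Preadditive C] [HasZeroObject C] [HasShift C ℤ]
  [∀ n : ℤ, (shiftFunctor C n).Additive] [Pretriangulated C]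

lemma smallGen_zero (G : ℤ → ObjectProperty C) (s : Set ℤ) (X : C) (hX : IsZero X) :
    smallGen G s X := by
  let c : Cofan (fun i : Fin 0 ↦ i.elim0 : Fin 0 → C) := Cofan.mk X fun i ↦ i.elim0
  have hc : IsColimit c := Cofan.IsColimit.mk _ (fun _ ↦ 0) (fun _ i ↦ i.elim0)
    (fun _ _ _ ↦ hX.eq_of_src _ _)
  exact ObjectProperty.le_retractClosure _ _ (coprod.sum 0 _ c hc fun i ↦ i.elim0)

lemma smallGen_retract {G : ℤ → ObjectProperty C} {s : Set ℤ} {X Y : C} (r : Retract X Y)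
    (hY : smallGen G s Y) : smallGen G s X := by
  obtain ⟨Z, hZ, ⟨r'⟩⟩ := hY
  exact ⟨Z, hZ, ⟨r.trans r'⟩⟩

lemma smallGen_iso {G : ℤ → ObjectProperty C} {s : Set ℤ} {X Y : C} (e : X ≅ Y)
    (hX : smallGen G s X) : smallGen G s Y :=
  smallGen_retract (Retract.ofIso e.symm) hX

lemma smallGen_ext {G : ℤ → ObjectProperty C} {s : Set ℤ} (T : Triangle C)
    (hT : T ∈ distTriang C) (h₁ : smallGen G s T.obj₁) (h₃ : smallGen G s T.obj₃) :
    smallGen G s T.obj₂ := by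
  obtain ⟨Y, ⟨A, B, f, g, h, hT', hA, hB⟩, ⟨r⟩⟩ :=
    ObjectProperty.extensionProduct_retractClosure_retractClosure_le (coprod (union G s))
      (coprod (union G s)) T.obj₂ ⟨_, _, _, _, _, hT, h₁, h₃⟩
  exact ⟨Y, coprod.ext _ hT' hA hB, ⟨r⟩⟩

lemma smallGen_of_mem {G : ℤ → ObjectProperty C} {s : Set ℤ} {n : ℤ} (hn : n ∈ s) :
    G n ≤ smallGen G s :=
  fun X hX ↦ ObjectProperty.le_retractClosure _ _ (coprod.of_mem X ⟨n, hn, hX⟩)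

lemma smallGen_mono (G : ℤ → ObjectProperty C) {s s' : Set ℤ} (h : s ⊆ s') :
    smallGen G s ≤ smallGen G s' :=
  smallGen_le_of_ext (smallGen_zero G s') smallGen_ext smallGen_retract
    fun _ hn ↦ smallGen_of_mem (h hn)

lemma smallGen_biprod {G : ℤ → ObjectProperty C} {s : Set ℤ} {X Y : C} (hX : smallGen G s X)
    (hY : smallGen G s Y) : smallGen G s (X ⊞ Y) :=
  smallGen_ext _ (binaryBiproductTriangle_distinguished X Y) hX hY

lemma metricM_anti (G : ℤ → ObjectProperty C) {i j : ℤ} (h : i ≤ j) :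
    metricM G j ≤ metricM G i :=
  smallGen_mono G (Set.Iic_subset_Iic.2 (by lia))

lemma shift_smallGen {G : ℤ → ObjectProperty C} {s s' : Set ℤ} {t : ℤ}
    (h : ∀ n ∈ s, ∀ X, G n X → smallGen G s' (X⟦t⟧)) (X : C) (hX : smallGen G s X) :
    smallGen G s' (X⟦t⟧) :=
  smallGen_le_of_ext (P := fun X ↦ smallGen G s' (X⟦t⟧))
    (fun _ hX ↦ smallGen_zero G s' _ ((shiftFunctor C t).map_isZero hX))
    (fun T hT h₁ h₃ ↦ smallGen_ext _ (Triangle.shift_distinguished T hT t) h₁ h₃)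
    (fun r h ↦ smallGen_retract (r.map (shiftFunctor C t)) h) h X hX

lemma metricM_shift_pos {G : ℤ → ObjectProperty C} (hG : IsGeneratingSequence G) (i : ℤ) (X : C)
    (hX : metricM G (i + 1) X) : metricM G i (X⟦(1 : ℤ)⟧) :=
  shift_smallGen (fun n hn X hX ↦ smallGen_mono G (fun m hm ↦ by
    simp only [Set.mem_Iic, Set.mem_Icc] at *; lia) _ (hG.shift_pos n X hX)) X hX

lemma metricM_shift_neg {G : ℤ → ObjectProperty C} (hG : IsGeneratingSequence G) (i : ℤ) (X : C)
    (hX : metricM G (i + 1) X) : metricM G i (X⟦(-1 : ℤ)⟧) :=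
  shift_smallGen (fun n hn X hX ↦ smallGen_mono G (fun m hm ↦ by
    simp only [Set.mem_Iic, Set.mem_Icc] at *; lia) _ (hG.shift_neg n X hX)) X hX

lemma leftOrthogonal_anti {P Q : ObjectProperty C} (h : P ≤ Q) :
    Q.leftOrthogonal ≤ P.leftOrthogonal :=
  fun _ hX _ f hY ↦ hX f (h _ hY)

lemma rightOrthogonal_anti {P Q : ObjectProperty C} (h : P ≤ Q) :
    Q.rightOrthogonal ≤ P.rightOrthogonal :=
  fun _ hX _ f hY ↦ hX f (h _ hY)

lemma metricR_anti (G : ℤ → ObjectProperty C) {i j : ℤ} (h : i ≤ j) :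
    metricR G j ≤ metricR G i :=
  leftOrthogonal_anti (rightOrthogonal_anti (metricM_anti G h))

lemma metricM_le_metricR (G : ℤ → ObjectProperty C) (i : ℤ) : metricM G i ≤ metricR G i :=
  fun _ hX _ f hY ↦ hY f hX

lemma leftOrthogonal_retract {P : ObjectProperty C} {X Y : C} (r : Retract X Y)
    (hY : P.leftOrthogonal Y) : P.leftOrthogonal X := fun Z f hZ ↦ by
  have := congrArg (fun t ↦ r.i ≫ t) (hY (r.r ≫ f) hZ)
  simpa using this

lemma leftOrthogonal_obj₂ {P : ObjectProperty C} {T : Triangle C} (hT : T ∈ distTriang C)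
    (h₁ : P.leftOrthogonal T.obj₁) (h₃ : P.leftOrthogonal T.obj₃) : P.leftOrthogonal T.obj₂ :=
  P.leftOrthogonal.ext_of_isTriangulatedClosed₂ T hT h₁ h₃

lemma metricR_shift_of_metricM {G : ℤ → ObjectProperty C} {i l t : ℤ}
    (h : ∀ X, metricM G i X → metricM G l (X⟦t⟧)) (X : C) (hX : metricR G i X) :
    metricR G l (X⟦t⟧) := fun _ f hY ↦
  (forall_shift_eq_zero_iff (add_neg_cancel t)).2 (fun g ↦ hX g fun Z a hZ ↦
    (forall_shift_eq_zero_iff (add_neg_cancel t)).1 (fun b ↦ hY b (h Z hZ)) a) f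

lemma metricR_shift_pos {G : ℤ → ObjectProperty C} (hG : IsGeneratingSequence G) (i : ℤ) (X : C)
    (hX : metricR G (i + 1) X) : metricR G i (X⟦(1 : ℤ)⟧) :=
  metricR_shift_of_metricM (metricM_shift_pos hG i) X hX

lemma metricR_shift_neg {G : ℤ → ObjectProperty C} (hG : IsGeneratingSequence G) (i : ℤ) (X : C)
    (hX : metricR G (i + 1) X) : metricR G i (X⟦(-1 : ℤ)⟧) :=
  metricR_shift_of_metricM (metricM_shift_neg hG i) X hX

lemma allSums_le_leftOrthogonal {U P : ObjectProperty C} (h : U ≤ P.leftOrthogonal) :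
    allSums U ≤ P.leftOrthogonal := by
  rintro X ⟨J, ⟨p⟩⟩ Y f hY
  exact p.isColimit.hom_ext fun j ↦ by
    rw [h _ (p.prop_diag_obj j) (_ ≫ f) hY, comp_zero]

lemma extensionProductIter_le {U P : ObjectProperty C} (h : U ≤ P)
    (hext : P.extensionProduct P ≤ P) (n : ℕ) : U.extensionProductIter n ≤ P := by
  induction n with
  | zero => exact h
  | succ n ih =>
    rw [ObjectProperty.extensionProductIter_succ]
    exact ((ObjectProperty.monotone_extensionProduct_left _ h).trans
      (ObjectProperty.monotone_extensionProduct_right _ ih)).trans hext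

lemma bigGen_le_leftOrthogonal {G : ℤ → ObjectProperty C} {s : Set ℤ} {P : ObjectProperty C}
    (h : ∀ n ∈ s, G n ≤ P.leftOrthogonal) (m : ℕ) : bigGen G s m ≤ P.leftOrthogonal := by
  rintro X ⟨Y, hY, ⟨r⟩⟩
  refine leftOrthogonal_retract r (extensionProductIter_le (allSums_le_leftOrthogonal ?_) ?_ _ Y hY)
  · rintro Z ⟨n, hn, hZ⟩
    exact h n hn Z hZ
  · rintro Z ⟨A, B, f, g, h, hT, hA, hB⟩
    exact leftOrthogonal_obj₂ hT hA hB

/-- The objects admitting no nonzero morphism to `F`. -/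
abbrev homZero (F : C) : ObjectProperty C :=
  ObjectProperty.leftOrthogonal (fun Y ↦ Y = F)

lemma homZero_iff (F X : C) : homZero F X ↔ ∀ f : X ⟶ F, f = 0 :=
  ⟨fun h f ↦ h f rfl, fun h Y f hY ↦ by obtain rfl : Y = F := hY; exact h f⟩

lemma exists_metricM_of_compacts {G : ℤ → ObjectProperty C} (hG : IsGeneratingSequence G) {X : C}
    (hX : compacts C X) : ∃ b : ℤ, ∀ i ≤ b, metricM G i X := by
  suffices ∃ b : ℤ, metricM G b X by
    obtain ⟨b, hb⟩ := this
    exact ⟨b, fun i hi ↦ metricM_anti G hi _ hb⟩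
  rw [← hG.generates] at hX
  refine smallGen_le_of_ext (P := fun X ↦ ∃ b, metricM G b X)
    (fun X hX ↦ ⟨0, smallGen_zero G _ X hX⟩) ?_ ?_ ?_ X hX
  · rintro T hT ⟨a, ha⟩ ⟨b, hb⟩
    exact ⟨min a b, smallGen_ext T hT (metricM_anti G (min_le_left a b) _ ha)
      (metricM_anti G (min_le_right a b) _ hb)⟩
  · rintro X Y r ⟨b, hb⟩
    exact ⟨b, smallGen_retract r hb⟩
  · intro n _ X hX
    exact ⟨-n, smallGen_of_mem (by simp) X hX⟩

section Orthogonal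

variable {R : ℤ → ObjectProperty C} (hR : IsOrthogonalMetric R)
include hR

lemma IsOrthogonalMetric.anti {i j : ℤ} (h : i ≤ j) : R j ≤ R i := by
  induction j, h using Int.leInduction with
  | base => exact le_rfl
  | succ j _ ih => exact (hR.self j).trans ih

lemma IsOrthogonalMetric.obj₂ {i : ℤ} {T : Triangle C} (hT : T ∈ distTriang C)
    (h₁ : R i T.obj₁) (h₃ : R i T.obj₃) : R i T.obj₂ :=
  hR.ext i _ ⟨_, _, _, _, _, hT, h₁, h₃⟩

end Orthogonal

variable {G R : ℤ → ObjectProperty C} {A : ℕ}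

lemma IsPreapproximableWith.metricR_le (h : IsPreapproximableWith G R A) {i j : ℤ}
    (hij : i + A ≤ j) : metricR G j ≤ R i := by
  rw [← h.metric.orthogonal i]
  exact (metricR_anti G hij).trans (leftOrthogonal_anti (rightOrthogonal_anti
    fun X hX ↦ (h.metricM_le i X hX).1))

lemma IsQuasiapproximableWith.exists_eq_zero_of_compacts (h : IsQuasiapproximableWith G R A)
    (hG : IsGeneratingSequence G) {X : C} (hX : compacts C X) :
    ∃ l : ℤ, ∀ i, l ≤ i → ∀ Y, R i Y → ∀ f : X ⟶ Y, f = 0 := by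
  suffices ∃ l : ℤ, ∀ Y, R l Y → homZero Y X by
    obtain ⟨l, hl⟩ := this
    exact ⟨l, fun i hi Y hY ↦ (homZero_iff _ _).1 (hl Y (h.metric.anti hi _ hY))⟩
  rw [← hG.generates] at hX
  refine smallGen_le_of_ext (P := fun X ↦ ∃ l : ℤ, ∀ Y, R l Y → homZero Y X) ?_ ?_ ?_ ?_ X hX
  · exact fun X hX ↦ ⟨0, fun Y _ ↦ (homZero_iff _ _).2 fun f ↦ hX.eq_of_src _ _⟩
  · rintro T hT ⟨a, ha⟩ ⟨b, hb⟩
    exact ⟨max a b, fun Y hY ↦ leftOrthogonal_obj₂ hT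
      (ha Y (h.metric.anti (le_max_left a b) _ hY)) (hb Y (h.metric.anti (le_max_right a b) _ hY))⟩
  · rintro X Y r ⟨b, hb⟩
    exact ⟨b, fun Z hZ ↦ leftOrthogonal_retract r (hb Z hZ)⟩
  · intro n _ X hX
    exact ⟨A - n, fun Y hY ↦ (homZero_iff _ _).2 fun f ↦
      h.hom_eq_zero_of_le n (A - n) (by lia) Y hY f hX⟩

lemma IsQuasiapproximableWith.exists_metricR_eq_zero_of_compacts
    (h : IsQuasiapproximableWith G R A) (hG : IsGeneratingSequence G) {X : C}
    (hX : compacts C X) : ∃ l : ℤ, ∀ i, l ≤ i → ∀ Y, metricR G i Y → ∀ f : X ⟶ Y, f = 0 := by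
  obtain ⟨l, hl⟩ := h.exists_eq_zero_of_compacts hG hX
  exact ⟨l + A, fun i hi Y hY ↦ hl l le_rfl Y (h.metricR_le hi Y hY)⟩

/-- Condition 0 lets the shift depend on the object. If none of the finitely many allowed shifts
worked uniformly, the direct sum of one counterexample for each would violate condition 0, because
the metrics are closed under summands. -/
lemma IsPreapproximableWith.exists_metricM_shift (h : IsPreapproximableWith G R A) (i : ℤ) :
    ∃ n : ℤ, ∀ X, metricM G i X → metricM G (i + 1) (X⟦n⟧) := by
  by_contra! hcon
  have key : ∀ S : Finset ℤ, ∃ X, metricM G i X ∧ ∀ n ∈ S, ¬ metricM G (i + 1) (X⟦n⟧) := by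
    intro S
    induction S using Finset.induction_on with
    | empty => exact ⟨_, smallGen_zero G _ _ (isZero_zero C), by simp⟩
    | insert a S _ ih =>
      obtain ⟨X, hX, hXS⟩ := ih
      obtain ⟨Y, hY, hYa⟩ := hcon a
      refine ⟨X ⊞ Y, smallGen_biprod hX hY, fun n hn hXY ↦ ?_⟩
      obtain rfl | hn := Finset.mem_insert.1 hn
      · exact hYa (smallGen_retract
          (Retract.map ⟨biprod.inr, biprod.snd, biprod.inr_snd⟩ (shiftFunctor C n)) hXY)
      · exact hXS n hn (smallGen_retract
          (Retract.map ⟨biprod.inl, biprod.fst, biprod.inl_fst⟩ (shiftFunctor C n)) hXY)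
  obtain ⟨X, hX, hXA⟩ := key (Finset.Icc (-A) A)
  obtain ⟨n, hn, Y, hY, ⟨e⟩⟩ := h.shift_bound i X hX
  rw [abs_le] at hn
  refine hXA (-n) (Finset.mem_Icc.2 ⟨by lia, by lia⟩) (smallGen_iso ?_ hY)
  exact ((shiftFunctor C (-n)).mapIso e ≪≫ shiftShiftNeg Y n).symm

lemma IsPreapproximableWith.exists_odd_shift (h : IsPreapproximableWith G R A)
    (hG : IsGeneratingSequence G) (i l : ℤ) :
    ∃ t : ℤ, ∀ X, metricR G i X → metricR G l (X⟦2 * t + 1⟧) := by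
  have key : ∀ m : ℕ, ∃ t : ℤ, ∀ X, metricM G i X → metricM G (i + m) (X⟦t⟧) := by
    intro m
    induction m with
    | zero => exact ⟨0, fun X hX ↦ smallGen_iso ((shiftFunctorZero C ℤ).app X).symm (by simpa)⟩
    | succ m ih =>
      obtain ⟨t, ht⟩ := ih
      obtain ⟨n, hn⟩ := h.exists_metricM_shift (i + m)
      refine ⟨t + n, fun X hX ↦ smallGen_iso ((shiftFunctorAdd C t n).app X).symm ?_⟩
      have := hn _ (ht X hX)
      rwa [add_assoc] at this
  -- Aiming one index deeper than `l` leaves room for one extra suspension when the shift obtained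
  -- is even.
  obtain ⟨t, ht⟩ := key (l + 1 - i).toNat
  obtain ⟨s, hs | hs⟩ := Int.even_or_odd' t
  · refine ⟨s, metricR_shift_of_metricM fun X hX ↦ ?_⟩
    have h1 := metricM_shift_pos hG l _ (metricM_anti G (j := i + (l + 1 - i).toNat) (by lia) _
      (ht X hX))
    exact smallGen_iso ((shiftFunctorAdd' C t 1 (2 * s + 1) (by lia)).app X).symm h1
  · refine ⟨s, metricR_shift_of_metricM fun X hX ↦ ?_⟩
    rw [← hs]
    exact metricM_anti G (by lia) _ (ht X hX)

end Metrics

/-! ### The closure of the compacts: extensions, vanishing and membership in R^G -/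

section Closure

variable {C : Type u} [Category.{v} C] [Preadditive C] [HasZeroObject C] [HasShift C ℤ]
  [∀ n : ℤ, (shiftFunctor C n).Additive] [Pretriangulated C] [HasCoproducts.{v} C]
  {G R : ℤ → ObjectProperty C} {A : ℕ}

lemma metricR_of_isZero (G : ℤ → ObjectProperty C) (i : ℤ) {X : C} (hX : IsZero X) :
    metricR G i X :=
  fun _ _ _ ↦ hX.eq_of_src _ _

lemma metricR_retract {i : ℤ} {X Y : C} (r : Retract X Y) (hY : metricR G i Y) :
    metricR G i X :=
  leftOrthogonal_retract r hY

lemma metricR_obj₂ {i : ℤ} {T : Triangle C} (hT : T ∈ distTriang C)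
    (h₁ : metricR G i T.obj₁) (h₃ : metricR G i T.obj₃) : metricR G i T.obj₂ :=
  leftOrthogonal_obj₂ hT h₁ h₃

lemma closureG_iso {X Y : C} (e : X ≅ Y) (hX : closureG G X) : closureG G Y :=
  fun n ↦ ObjectProperty.prop_of_iso _ e (hX n)

lemma closureG_of_compacts {X : C} (hX : compacts C X) : closureG G X := fun n ↦
  ⟨_, _, _, _, _, contractible_distinguished X, hX, metricR_of_isZero G n (isZero_zero C)⟩

lemma closureG_shift_pos (hG : IsGeneratingSequence G) {X : C} (hX : closureG G X) :
    closureG G (X⟦(1 : ℤ)⟧) := by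
  intro n
  obtain ⟨E, D, f, g, h, hT, hE, hD⟩ := hX (n + 1)
  exact ⟨_, _, _, _, _, Triangle.shift_distinguished _ hT 1, compacts_shift hE 1,
    metricR_shift_pos hG n D hD⟩

lemma closureG_shift_neg (hG : IsGeneratingSequence G) {X : C} (hX : closureG G X) :
    closureG G (X⟦(-1 : ℤ)⟧) := by
  intro n
  obtain ⟨E, D, f, g, h, hT, hE, hD⟩ := hX (n + 1)
  exact ⟨_, _, _, _, _, Triangle.shift_distinguished _ hT (-1), compacts_shift hE (-1),
    metricR_shift_neg hG n D hD⟩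

lemma closureG_shift (hG : IsGeneratingSequence G) {X : C} (hX : closureG G X) (n : ℤ) :
    closureG G (X⟦n⟧) := by
  induction n using Int.induction_on with
  | zero => exact closureG_iso ((shiftFunctorZero C ℤ).app X).symm hX
  | succ i hi =>
    exact closureG_iso ((shiftFunctorAdd C (i : ℤ) 1).app X).symm (closureG_shift_pos hG hi)
  | pred i hi =>
    exact closureG_iso ((shiftFunctorAdd' C (-i : ℤ) (-1) (-i - 1) (by lia)).app X).symm
      (closureG_shift_neg hG hi)

section Extensions

variable [IsTriangulated C]

/-- T^c ⋆ R ⋆ T^c ⋆ R is regrouped by associativity of ⋆. If the first R is deep enough compared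
with the second compact, the extension between them splits, so the two can be exchanged and equal
classes merged. -/
lemma IsQuasiapproximableWith.closureG_obj₂ (h : IsQuasiapproximableWith G R A)
    (hG : IsGeneratingSequence G) {T : Triangle C} (hT : T ∈ distTriang C)
    (h₁ : closureG G T.obj₁) (h₃ : closureG G T.obj₃) : closureG G T.obj₂ := by
  intro n
  obtain ⟨E, D, f, g, w, hT₃, hE, hD⟩ := h₃ n
  obtain ⟨l, hl⟩ := h.exists_metricR_eq_zero_of_compacts hG hE
  let Q : ObjectProperty C := compacts C ⊓ (metricR G l).leftOrthogonal
  have hQ : Q.extensionProduct (metricR G n) T.obj₃ :=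
    ⟨E, D, f, g, w, hT₃, ⟨hE, fun Y f hY ↦ hl l le_rfl Y hY f⟩, hD⟩
  have hcc : (compacts C).extensionProduct (compacts C) ≤ compacts C := by
    rintro X ⟨_, _, _, _, _, hT, h₁, h₃⟩
    exact compacts_obj₂ hT h₁ h₃
  have hrr : (metricR G n).extensionProduct (metricR G n) ≤ metricR G n := by
    rintro X ⟨_, _, _, _, _, hT, h₁, h₃⟩
    exact metricR_obj₂ hT h₁ h₃
  have hswap : (metricR G (max (l + 1) n)).extensionProduct Q ≤
      (compacts C).extensionProduct (metricR G n) := by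
    rintro X ⟨D', E', f', g', w', hT', hD', hE', hEl⟩
    -- The connecting map lands in D'⟦1⟧, which costs one index; hence `l + 1` above.
    have hw : w' = 0 := hEl w' (metricR_shift_pos hG l D' (metricR_anti G (le_max_left _ _) _ hD'))
    obtain ⟨e, -, -⟩ := exists_iso_binaryBiproduct_of_distTriang _ hT' hw
    refine ObjectProperty.prop_of_iso _ (e ≪≫ biprod.braiding D' E').symm ?_
    exact ⟨_, _, _, _, _, binaryBiproductTriangle_distinguished E' D', hE',
      metricR_anti G (le_max_right _ _) _ hD'⟩
  have key : ((compacts C).extensionProduct (metricR G (max (l + 1) n))).extensionProduct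
      (Q.extensionProduct (metricR G n)) T.obj₂ := ⟨_, _, _, _, _, hT, h₁ _, hQ⟩
  rw [ObjectProperty.extensionProduct_assoc, ← ObjectProperty.extensionProduct_assoc _ Q] at key
  have key₂ := ObjectProperty.monotone_extensionProduct_right _
    (ObjectProperty.monotone_extensionProduct_left _ hswap) _ key
  rw [ObjectProperty.extensionProduct_assoc, ← ObjectProperty.extensionProduct_assoc] at key₂
  exact ObjectProperty.monotone_extensionProduct_left _ hcc _
    (ObjectProperty.monotone_extensionProduct_right _ hrr _ key₂)

/-- By the octahedral axiom, the cone of Y ⊞ X → X → X ⊞ Z is Y⟦1⟧ ⊞ Z. So the summand Y can be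
traded for Z, which lets the next lemma change the odd shift by two at a time. -/
lemma IsQuasiapproximableWith.closureG_biprod_of_biprod (h : IsQuasiapproximableWith G R A)
    (hG : IsGeneratingSequence G) {X Y Z : C} (h₁ : closureG G (Y ⊞ X))
    (h₂ : closureG G (Y⟦(1 : ℤ)⟧ ⊞ Z)) : closureG G (X ⊞ Z) := by
  obtain ⟨W, a, b, hW⟩ := distinguished_cocone_triangle
    ((biprod.snd : Y ⊞ X ⟶ X) ≫ (biprod.inl : X ⟶ X ⊞ Z))
  let O := (Triangulated.someOctahedron rfl
    (rot_of_distTriang _ (binaryBiproductTriangle_distinguished Y X))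
    (binaryBiproductTriangle_distinguished X Z) hW)
  obtain ⟨e, -, -⟩ := exists_iso_binaryBiproduct_of_distTriang _ O.mem zero_comp
  exact h.closureG_obj₂ hG hW h₁ (closureG_iso e.symm h₂)

lemma IsQuasiapproximableWith.closureG_biprod_odd_shift (h : IsQuasiapproximableWith G R A)
    (hG : IsGeneratingSequence G) {F : C} (hF : closureG G (F ⊞ F⟦(1 : ℤ)⟧)) (m : ℤ) :
    closureG G (F ⊞ F⟦2 * m + 1⟧) := by
  have hiso {X X' Y Y' : C} (e : X ≅ X') (e' : Y ≅ Y') (hX : closureG G (X ⊞ Y)) :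
      closureG G (X' ⊞ Y') := closureG_iso (biprod.mapIso e e') hX
  have hshift (n : ℤ) : closureG G (F⟦n⟧ ⊞ F⟦n + 1⟧) := by
    have h1 := closureG_shift hG hF n
    have : PreservesBinaryBiproducts (shiftFunctor C n) :=
      preservesBinaryBiproducts_of_preservesBiproducts _
    refine closureG_iso ((shiftFunctor C n).mapBiprod _ _ ≪≫ biprod.mapIso (Iso.refl _) ?_) h1
    exact ((shiftFunctorAdd' C 1 n (n + 1) (by lia)).app F).symm
  have hbr {X Y : C} (hX : closureG G (X ⊞ Y)) : closureG G (Y ⊞ X) :=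
    closureG_iso (biprod.braiding X Y) hX
  induction m using Int.induction_on with
  | zero => simpa using hF
  | succ m ih =>
    refine h.closureG_biprod_of_biprod hG (hbr ih) ?_
    refine hiso ((shiftFunctorAdd' C (2 * m + 1 : ℤ) 1 (2 * m + 2) (by lia)).app F)
      (eqToIso (by congr 1)) (hshift (2 * m + 2))
  | pred m ih =>
    refine hbr (h.closureG_biprod_of_biprod hG (Y := F⟦2 * (-m : ℤ)⟧) ?_ ?_)
    · refine hbr (hiso (Iso.refl _) (eqToIso ?_) (hshift (2 * (-m - 1) + 1)))
      congr 2
      lia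
    · exact hbr (hiso (Iso.refl _) ((shiftFunctorAdd' C _ 1 _ rfl).app F) ih)

end Extensions

/-- There is no nonzero morphism from the objects of `G n` to `F`, for all `n ≥ N`. -/
def VanishesFrom (G : ℤ → ObjectProperty C) (N : ℤ) (F : C) : Prop :=
  ∀ n, N ≤ n → ∀ X, G n X → ∀ f : X ⟶ F, f = 0

lemma VanishesFrom.mono {N N' : ℤ} (hN : N ≤ N') {F : C} (hF : VanishesFrom G N F) :
    VanishesFrom G N' F :=
  fun n hn ↦ hF n (hN.trans hn)

lemma IsQuasiapproximableWith.vanishesFrom_of_metricR (h : IsQuasiapproximableWith G R A)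
    {b : ℤ} {F : C} (hF : metricR G b F) : VanishesFrom G (2 * A - b) F := fun n hn X hX f ↦
  h.hom_eq_zero_of_le n (b - A) (by lia) F (h.metricR_le (by lia) F hF) f hX

lemma VanishesFrom.obj₂ {N : ℤ} {X Y Z : C} {f : X ⟶ Y} {g : Y ⟶ Z}
    {w : Z ⟶ X⟦(1 : ℤ)⟧} (hT : Triangle.mk f g w ∈ distTriang C) (hX : VanishesFrom G N X)
    (hZ : VanishesFrom G N Z) : VanishesFrom G N Y := fun n hn Q hQ q ↦ by
  obtain ⟨p, rfl⟩ := dist_lift₂ hT q (hZ n hn Q hQ _)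
  rw [hX n hn Q hQ p, zero_comp]

lemma IsQuasiapproximableWith.exists_vanishesFrom (h : IsQuasiapproximableWith G R A)
    (hG : IsGeneratingSequence G) {F : C} (hF : closureG G F) : ∃ N, VanishesFrom G N F := by
  obtain ⟨E, D, f, g, w, hT, hE, hD⟩ := hF 0
  obtain ⟨b, hb⟩ := exists_metricM_of_compacts hG hE
  have h₁ := h.vanishesFrom_of_metricR (metricM_le_metricR G b _ (hb b le_rfl))
  have h₂ := h.vanishesFrom_of_metricR hD
  exact ⟨max _ _, VanishesFrom.obj₂ hT (h₁.mono (le_max_left _ _)) (h₂.mono (le_max_right _ _))⟩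

lemma IsQuasiapproximableWith.homFinite {k : Type w} [CommRing k] [Linear k C]
    (h : IsQuasiapproximableWith G R A) (hG : IsGeneratingSequence G)
    (hhom : compacts C ≤ HomFinite k) {F : C} (hF : closureG G F) : HomFinite k F := by
  intro Q hQ
  obtain ⟨l, hl⟩ := h.exists_metricR_eq_zero_of_compacts hG hQ
  obtain ⟨E, D, f, g, w, hT, hE, hD⟩ := hF l
  have := hhom E hE Q hQ
  exact Module.Finite.of_surjective (Linear.rightComp k Q f) fun q ↦
    dist_lift₂ hT q (hl l le_rfl D hD _)

/-- The objects with a filtration of length `m`, whose successive quotients are the ones provided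
by the approximation triangles at the indices `i`, `i + 1`, …, `i + m - 1`. -/
def approxClass (G : ℤ → ObjectProperty C) (A : ℕ) (i : ℤ) : ℕ → ObjectProperty C
  | 0 => IsZero
  | m + 1 => (bigGen G (Set.Icc (-A - i) (A - i)) A).extensionProduct (approxClass G A (i + 1) m)

lemma approxClass_le_leftOrthogonal {P : ObjectProperty C} (i : ℤ) (m : ℕ)
    (hP : ∀ n, -A - i - m < n → n ≤ A - i → G n ≤ P.leftOrthogonal) :
    approxClass G A i m ≤ P.leftOrthogonal := by
  induction m generalizing i with
  | zero => exact fun X hX _ _ _ ↦ IsZero.eq_of_src hX _ _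
  | succ m ih =>
    rintro X ⟨B, D, f, g, w, hT, hB, hD⟩
    exact leftOrthogonal_obj₂ hT
      (bigGen_le_leftOrthogonal (fun n hn ↦ hP n (by push_cast; grind) hn.2) _ B hB)
      (ih (i + 1) (fun n h₁ h₂ ↦ hP n (by push_cast; lia) (by lia)) D hD)

variable [IsTriangulated C]

lemma IsQuasiapproximableWith.exists_approx (h : IsQuasiapproximableWith G R A) (i : ℤ) (m : ℕ)
    {F : C} (hF : R i F) (hF' : closureG G F) :
    (approxClass G A i m).extensionProduct (R (i + m) ⊓ closureG G) F := by
  induction m generalizing i F with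
  | zero =>
    refine ⟨_, F, _, 𝟙 F, _, contractible_distinguished₁ F, isZero_zero C, ?_, hF'⟩
    simpa using hF
  | succ m ih =>
    obtain ⟨E, D, a, b, c, hT, hE, hD, hD'⟩ := h.approx i F hF hF'
    have key := ih (i + 1) hD hD'
    rw [approxClass, ObjectProperty.extensionProduct_assoc]
    refine ⟨E, D, a, b, c, hT, hE, ?_⟩
    convert key using 3
    push_cast
    ring

lemma IsQuasiapproximableWith.metricR_of_compacts (h : IsQuasiapproximableWith G R A)
    (hG : IsGeneratingSequence G) {j : ℤ} {K : C} (hK : compacts C K) (hK' : R j K) :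
    metricR G (j - A) K := by
  obtain ⟨l, hl⟩ := h.exists_eq_zero_of_compacts hG hK
  obtain ⟨P, D, a, b, c, hT, hP, hD, -⟩ := h.exists_approx j (l - j).toNat hK'
    (closureG_of_compacts hK)
  obtain ⟨s, hs⟩ := dist_lift₂ hT (𝟙 K) (hl _ (by lia) D hD _)
  -- The approximation runs until no nonzero map `K` → `D` is left, so `K` is a retract of `P`,
  -- which is built from generators of index at most `A - j`.
  refine metricR_retract ⟨s, a, hs⟩ (approxClass_le_leftOrthogonal j _ (fun n _ hn X hX ↦ ?_) P hP)
  exact metricM_le_metricR G (j - A) X (smallGen_of_mem (by simp only [Set.mem_Iic]; lia) X hX)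

/-- The part of E built from generators of index at least `N` has no maps to F, so the map factors
through the quotient `D`. As `D` is in the closure, E → D lifts to a compact `K`, which inherits the
depth of `D`. -/
lemma IsQuasiapproximableWith.exists_factorization (h : IsQuasiapproximableWith G R A)
    (hG : IsGeneratingSequence G) {N : ℤ} {F : C} (hF : VanishesFrom G N F) {E : C} (x : E ⟶ F)
    (hE : compacts C E) : ∃ (K : C) (x' : K ⟶ F) (t : E ⟶ K), t ≫ x' = x ∧ compacts C K ∧
      metricR G (1 - 2 * A - N) K := by
  obtain ⟨b, hb⟩ := exists_metricM_of_compacts hG hE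
  -- The approximation steps of index below `j` involve only G^n with n > -A - j = N - 1.
  obtain ⟨j, hj⟩ : ∃ j : ℤ, j = 1 - A - N := ⟨_, rfl⟩
  obtain ⟨i, hib, hij⟩ : ∃ i : ℤ, i + A ≤ b ∧ i ≤ j := ⟨min (b - A) j, by lia, by lia⟩
  obtain ⟨P, D, p, u, c, hT, hP, hD, hD'⟩ := h.exists_approx i (j - i).toNat
    (h.metricM_le i E (hb _ hib)).1 (closureG_of_compacts hE)
  have hPF : homZero F P := approxClass_le_leftOrthogonal i _ (fun n hn _ X hX ↦
    (homZero_iff F X).2 (hF n (by lia) X hX)) P hP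
  obtain ⟨y, hy⟩ := dist_desc₂ hT x ((homZero_iff F P).1 hPF _)
  have hDj : R j D := h.metric.anti (by lia) D hD
  obtain ⟨l, hl⟩ := h.exists_metricR_eq_zero_of_compacts hG hE
  obtain ⟨K, Q, f, g, w, hT', hK, hQ⟩ := hD' (max l (j + A + 1))
  obtain ⟨t, ht⟩ := dist_lift₂ hT' u (hl _ (le_max_left _ _) Q hQ _)
  have hQ' : R j (Q⟦(-1 : ℤ)⟧) := h.metricR_le le_rfl _
    (metricR_shift_neg hG (j + A) Q (metricR_anti G (le_max_right _ _) _ hQ))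
  have hKj : R j K := h.metric.obj₂ (inv_rot_of_distTriang _ hT') hQ' hDj
  refine ⟨K, f ≫ y, t, by rw [← Category.assoc, ht, hy], hK, ?_⟩
  have := h.metricR_of_compacts hG hK hKj
  rwa [show j - A = 1 - 2 * A - N by lia] at this

/-- F is a homotopy colimit of compacts from `exists_factorization`. One index is lost because the
suspensions of the terms must be orthogonal as well. -/
lemma IsQuasiapproximableWith.metricR_of_vanishesFrom {k : Type w} [CommRing k] [Linear k C]
    [IsNoetherianRing k] (h : IsQuasiapproximableWith G R A) (hC : IsCompactlyGenerated C)
    (hG : IsFiniteGeneratingSequence G) (hhom : compacts C ≤ HomFinite k) {F : C}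
    (hF : HomFinite k F) {N : ℤ} (hN : VanishesFrom G N F) : metricR G (-2 * A - N) F := by
  obtain ⟨X, x, hX, hX'⟩ := exists_isHocolim_of_homFinite hC hG hhom hF
    (metricR G (1 - 2 * A - N)) (fun E x hE ↦ h.exists_factorization hG.1 hN x hE)
  refine fun Y f hY ↦ hX.eq_zero Y (fun j φ ↦ ?_) (fun j φ ↦ ?_) f
  · exact metricR_anti G (by lia) _ (hX' j).2 φ hY
  · exact metricR_shift_pos hG.1 (-2 * A - N) _ (metricR_anti G (by lia) _ (hX' j).2) φ hY

end Closure

/-! ### Compact objects covering all maps from a big class -/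

section Covers

variable {C : Type u} [Category.{v} C] [Preadditive C] [HasZeroObject C] [HasShift C ℤ]
  [∀ n : ℤ, (shiftFunctor C n).Additive] [Pretriangulated C] [HasCoproducts.{v} C]
  {k : Type w} [CommRing k] [Linear k C] [IsNoetherianRing k]

lemma HomFinite.exists_extension (hhom : compacts C ≤ HomFinite k) {F : C} (hF : HomFinite k F)
    {V : Set C} (hV : V.Finite) {E : C} (hE : compacts C E) (x : E ⟶ F) :
    ∃ (E' : C) (x' : E' ⟶ F) (t : E ⟶ E'), t ≫ x' = x ∧ compacts C E' ∧
      (∀ Q ∈ V, compacts C Q → ∀ f : Q ⟶ F, ∃ q : Q ⟶ E', q ≫ x' = f) ∧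
      ∀ Q ∈ V, compacts C Q → ∀ q : Q ⟶ E, q ≫ x = 0 → q ≫ t = 0 := by
  obtain ⟨E', x', t, ht, h₁, h₂⟩ := exists_extension_of_finite
    (isCohomological_yonedaCompacts (k := k) F) (fun X ↦ hF _ X.2)
    (fun X Y hX hY ↦ hhom Y hY X hX) (E := ⟨E, hE⟩) x
    (finite_setOf_obj_mem (P := compacts C) hV)
  exact ⟨E'.obj, x', t, ht, E'.2, fun Q hQ hQ' ↦ h₁ ⟨Q, hQ'⟩ hQ, fun Q hQ hQ' ↦ h₂ ⟨Q, hQ'⟩ hQ⟩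

variable (k) in
/-- Each object `F` with finitely generated modules of morphisms from the compact objects admits a
morphism `E ⟶ F` from a compact object through which all morphisms from objects in `P` factor. -/
def HasCompactCovers (P : ObjectProperty C) : Prop :=
  ∀ F : C, HomFinite k F → ∃ (E : C) (p : E ⟶ F), compacts C E ∧
    ∀ B, P B → ∀ f : B ⟶ F, ∃ g : B ⟶ E, g ≫ p = f

lemma HasCompactCovers.allSums (hhom : compacts C ≤ HomFinite k) {U : ObjectProperty C}
    (hU : Set.Finite {X : C | U X}) (hU' : U ≤ compacts C) :
    HasCompactCovers k (allSums U) := by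
  intro F hF
  obtain ⟨E, x, -, -, hE, hx, -⟩ := hF.exists_extension hhom hU
    (compacts_of_isZero (isZero_zero C)) 0
  refine ⟨E, x, hE, ?_⟩
  rintro B ⟨J, ⟨p⟩⟩ f
  choose g hg using fun j ↦ hx _ (p.prop_diag_obj j) (hU' _ (p.prop_diag_obj j)) (p.ι.app j ≫ f)
  refine ⟨p.isColimit.desc ⟨E, Discrete.natTrans g⟩, p.isColimit.hom_ext fun j ↦ ?_⟩
  rw [p.isColimit.fac_assoc]
  exact hg j

lemma HasCompactCovers.retractClosure {P : ObjectProperty C} (hP : HasCompactCovers k P) :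
    HasCompactCovers k P.retractClosure := by
  intro F hF
  obtain ⟨E, p, hE, h⟩ := hP F hF
  refine ⟨E, p, hE, ?_⟩
  rintro B ⟨B', hB', ⟨r⟩⟩ f
  obtain ⟨g, hg⟩ := h B' hB' (r.r ≫ f)
  exact ⟨r.i ≫ g, by rw [Category.assoc, hg, r.retract_assoc]⟩

variable [∀ n : ℤ, (shiftFunctor C n).Linear k]

lemma HasCompactCovers.exists_shift {P : ObjectProperty C} (hP : HasCompactCovers k P) (n : ℤ)
    {F : C} (hF : HomFinite k F) : ∃ (E : C) (p : E ⟶ F), compacts C E ∧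
      ∀ B, P B → ∀ f : B⟦n⟧ ⟶ F, ∃ g : B⟦n⟧ ⟶ E, g ≫ p = f := by
  obtain ⟨E, p, hE, h⟩ := hP _ (hF.shift (-n))
  refine ⟨E⟦n⟧, p⟦n⟧' ≫ (shiftNegShift F n).hom, compacts_shift hE n, fun B hB f ↦ ?_⟩
  obtain ⟨g, hg⟩ := h B hB ((shiftFunctor C n).preimage (f ≫ (shiftNegShift F n).inv))
  exact ⟨g⟦n⟧', by rw [← Category.assoc, ← Functor.map_comp, hg, Functor.map_preimage, Category.assoc,
    Iso.inv_hom_id, Category.comp_id]⟩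

/-- A map b from an extension B of B₂ by B₁ is lifted on B₁ to E₁. The obstruction to extending the
lift to B is a map B₂⟦-1⟧ → E₁ that factors through the fibre W of p₁; coning off a compact cover of
W removes it. The remaining difference vanishes on B₁, hence comes from B₂ and lifts to E₂. -/
lemma HasCompactCovers.extensionProduct {P₁ P₂ : ObjectProperty C} (h₁ : HasCompactCovers k P₁)
    (h₂ : HasCompactCovers k P₂) (hhom : compacts C ≤ HomFinite k) :
    HasCompactCovers k (P₁.extensionProduct P₂) := by
  intro F hF
  obtain ⟨E₁, p₁, hE₁, hp₁⟩ := h₁ F hF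
  obtain ⟨E₂, p₂, hE₂, hp₂⟩ := h₂ F hF
  obtain ⟨W, i, w, hW⟩ := distinguished_cocone_triangle₁ p₁
  have hWF : HomFinite k W := HomFinite.obj₂ (inv_rot_of_distTriang _ hW) (hF.shift (-1))
    (hhom _ hE₁)
  obtain ⟨W₀, q, hW₀, hq⟩ := h₂.exists_shift (-1) hWF
  obtain ⟨E, e, c, hE⟩ := distinguished_cocone_triangle (q ≫ i)
  obtain ⟨p, hp⟩ := dist_desc₂ hE p₁ (by rw [Category.assoc, dist_comp₁₂ hW, comp_zero])
  refine ⟨E ⊞ E₂, biprod.desc p p₂, compacts_biprod (compacts_obj₃ hE hW₀ hE₁) hE₂, ?_⟩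
  rintro B ⟨B₁, B₂, f, g, h, hT, hB₁, hB₂⟩ b
  obtain ⟨β, hβ⟩ := hp₁ B₁ hB₁ (f ≫ b)
  have hT' := inv_rot_of_distTriang _ hT
  let δ : B₂⟦(-1 : ℤ)⟧ ⟶ B₁ := (Triangle.mk f g h).invRotate.mor₁
  have hδ : δ ≫ f = 0 := comp_distTriang_mor_zero₁₂ _ hT'
  obtain ⟨y, hy⟩ := dist_lift₂ hW (δ ≫ β) (by
    rw [Category.assoc, hβ, ← Category.assoc, hδ, zero_comp])
  obtain ⟨y₀, hy₀⟩ := hq B₂ hB₂ y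
  obtain ⟨γ, hγ⟩ : ∃ γ : B ⟶ E, β ≫ e = f ≫ γ := Triangle.yoneda_exact₂ _ hT' (β ≫ e) (by
    change δ ≫ β ≫ e = 0
    rw [← Category.assoc, ← hy, ← hy₀, Category.assoc, Category.assoc]
    have := dist_comp₁₂ hE
    rw [Category.assoc] at this
    rw [this, comp_zero])
  obtain ⟨b', hb'⟩ := dist_desc₂ hT (b - γ ≫ p) (by
    rw [Preadditive.comp_sub, ← Category.assoc, ← hγ, Category.assoc, hp, hβ, sub_self])
  obtain ⟨ε, hε⟩ := hp₂ B₂ hB₂ b'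
  exact ⟨biprod.lift γ (g ≫ ε), by simp [hε, hb']⟩

lemma HasCompactCovers.approxClass (hhom : compacts C ≤ HomFinite k) {G : ℤ → ObjectProperty C}
    (hG : IsFiniteGeneratingSequence G) (A : ℕ) (i : ℤ) (m : ℕ) :
    HasCompactCovers k (approxClass G A i m) := by
  induction m generalizing i with
  | zero =>
    exact fun F _ ↦ ⟨_, 0, compacts_of_isZero (isZero_zero C), fun B hB f ↦
      ⟨0, IsZero.eq_of_src hB _ _⟩⟩
  | succ m ih =>
    refine HasCompactCovers.extensionProduct (HasCompactCovers.retractClosure ?_) (ih (i + 1)) hhom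
    have hU : HasCompactCovers k (GApprox.allSums (union G (Set.Icc (-A - i) (A - i)))) := by
      refine HasCompactCovers.allSums hhom ?_ ?_
      · refine ((Set.finite_Icc (-A - i) (A - i)).biUnion fun n _ ↦ hG.finite n).subset ?_
        rintro X ⟨n, hn, hX⟩
        exact Set.mem_biUnion hn hX
      · rintro X ⟨n, -, hX⟩
        exact hG.le_compacts n X hX
    change HasCompactCovers k (ObjectProperty.extensionProductIter _ (A - 1))
    induction A - 1 with
    | zero => exact hU
    | succ n ih =>
      rw [ObjectProperty.extensionProductIter_succ]
      exact hU.extensionProduct ih hhom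

end Covers

/-! ### The cone of 1 - e for an approximate idempotent -/

section Splitting

variable {C : Type u} [Category.{v} C] [Preadditive C] [HasZeroObject C] [HasShift C ℤ]
  [∀ n : ℤ, (shiftFunctor C n).Additive] [Pretriangulated C]

lemma unshift_comp_eq_zero {Q X Y : C} (y : Q⟦(-1 : ℤ)⟧ ⟶ X) (f : X ⟶ Y)
    (h : ((shiftNegShift Q (1 : ℤ)).inv ≫ y⟦(1 : ℤ)⟧') ≫ f⟦(1 : ℤ)⟧' = 0) : y ≫ f = 0 := by
  refine (shiftFunctor C (1 : ℤ)).map_injective ?_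
  rw [← cancel_epi (shiftNegShift Q (1 : ℤ)).inv, Functor.map_comp, ← Category.assoc, h,
    Functor.map_zero, comp_zero]

/-- When `ι` is treated as invertible, e = ι⁻¹va preserves p₁ and kills its kernel, so it is
idempotent with image Hom(-, F). Thus 1 - e has kernel and cokernel Hom(-, F): the cokernel gives
the summand F of the cone `T`, and the kernel gives F⟦1⟧. The hypotheses on `Q` are exactly the
instances of this picture needed to make Hom(Q, X) vanish. -/
lemma eq_zero_of_biprod_cone {F E₀ E₁ P K T X : C} {p₀ : E₀ ⟶ F} {p₁ : E₁ ⟶ F} {a : E₀ ⟶ E₁}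
    (ha : a ≫ p₁ = p₀) {ι : P ⟶ E₁} {κ : E₁ ⟶ K} {δ : K ⟶ P⟦(1 : ℤ)⟧}
    (hK : Triangle.mk ι κ δ ∈ distTriang C) {v : P ⟶ E₀} (hv : v ≫ p₀ = ι ≫ p₁)
    {c : E₁ ⟶ T} {d : T ⟶ P⟦(1 : ℤ)⟧} (hT : Triangle.mk (ι - v ≫ a) c d ∈ distTriang C)
    {q : T ⟶ F} (hq : c ≫ q = p₁) {g : F ⊞ F⟦(1 : ℤ)⟧ ⟶ X} {w : X ⟶ T⟦(1 : ℤ)⟧}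
    (hX : Triangle.mk (biprod.lift q (d ≫ (ι ≫ p₁)⟦(1 : ℤ)⟧')) g w ∈ distTriang C) {Q : C}
    (hs : ∀ f : Q ⟶ F, ∃ s : Q ⟶ E₀, s ≫ p₀ = f)
    (hs' : ∀ f : Q⟦(-1 : ℤ)⟧ ⟶ F, ∃ s : Q⟦(-1 : ℤ)⟧ ⟶ E₀, s ≫ p₀ = f)
    (hk : ∀ s : Q⟦(-1 : ℤ)⟧ ⟶ E₀, s ≫ p₀ = 0 → s ≫ a = 0)
    (hk' : ∀ s : Q⟦(-1 : ℤ)⟧⟦(-1 : ℤ)⟧ ⟶ E₀, s ≫ p₀ = 0 → s ≫ a = 0)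
    (hQ : ∀ f : Q⟦(-1 : ℤ)⟧ ⟶ K, f = 0) (x : Q ⟶ X) : x = 0 := by
  have hιc : ι ≫ c = v ≫ a ≫ c := by
    have := dist_comp₁₂ hT
    rw [Preadditive.sub_comp, sub_eq_zero, Category.assoc] at this
    exact this
  -- The second component forces `y ≫ d = 0`, so `y` comes from E₁ and then from P; the first
  -- component shows that it is zero in the cone.
  have inj (y : Q⟦(-1 : ℤ)⟧ ⟶ T) (hy : y ≫ biprod.lift q (d ≫ (ι ≫ p₁)⟦(1 : ℤ)⟧') = 0) :
      y = 0 := by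
    have h₁ : y ≫ q = 0 := by
      have := congrArg (· ≫ biprod.fst) hy
      simpa using this
    have h₂ : (y ≫ d) ≫ (ι ≫ p₁)⟦(1 : ℤ)⟧' = 0 := by
      have := congrArg (· ≫ biprod.snd) hy
      simpa using this
    obtain ⟨z, hz⟩ := exists_unshift (y ≫ d)
    rw [hz] at h₂
    have h₃ : z ≫ (ι - v ≫ a) = 0 := unshift_comp_eq_zero z _ (by
      rw [← hz, Category.assoc, dist_comp₃₁ hT, comp_zero])
    have h₄ : (z ≫ v) ≫ a = 0 := hk' _ (by
      rw [Category.assoc, hv, unshift_comp_eq_zero z _ h₂])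
    have h₅ : z ≫ ι = 0 := by
      rw [Preadditive.comp_sub, sub_eq_zero] at h₃
      rw [h₃, ← Category.assoc, h₄]
    obtain ⟨r, hr⟩ := dist_lift₁ hK (y ≫ d) (by
      rw [hz, Category.assoc, ← Functor.map_comp, h₅, Functor.map_zero, comp_zero])
    rw [hQ r, zero_comp] at hr
    obtain ⟨y', rfl⟩ := dist_lift₃ hT y hr.symm
    obtain ⟨r', rfl⟩ := dist_lift₂ hK y' (hQ _)
    have h₆ : (r' ≫ v) ≫ a = 0 := hk _ (by
      rw [Category.assoc, hv, ← Category.assoc, ← hq, ← Category.assoc, h₁])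
    rw [Category.assoc, hιc, ← Category.assoc, ← Category.assoc, h₆, zero_comp]
  have surj (f : Q ⟶ F ⊞ F⟦(1 : ℤ)⟧) :
      ∃ y : Q ⟶ T, y ≫ biprod.lift q (d ≫ (ι ≫ p₁)⟦(1 : ℤ)⟧') = f := by
    obtain ⟨g', hg'⟩ := exists_unshift (f ≫ biprod.snd)
    obtain ⟨s, rfl⟩ := hs' g'
    obtain ⟨r, hr⟩ := dist_lift₂ hK (s ≫ a) (hQ _)
    have h₁ : (s - r ≫ v) ≫ a = 0 := hk _ (by
      rw [Preadditive.sub_comp, Category.assoc, hv, ← Category.assoc, hr, Category.assoc, ha,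
        sub_self])
    have h₂ : r ≫ (ι - v ≫ a) = 0 := by
      rw [Preadditive.comp_sub, hr, ← Category.assoc, ← Preadditive.sub_comp, h₁]
    obtain ⟨y, hy⟩ := dist_lift₁ hT ((shiftNegShift Q (1 : ℤ)).inv ≫ r⟦(1 : ℤ)⟧') (by
      rw [Category.assoc, ← Functor.map_comp, h₂, Functor.map_zero, comp_zero])
    -- `y` already has the right second component; a correction through `c` changes only the first
    -- one, because c ≫ d = 0.
    obtain ⟨s₂, hs₂⟩ := hs (f ≫ biprod.fst - y ≫ q)
    refine ⟨y + s₂ ≫ a ≫ c, biprod.hom_ext _ _ ?_ ?_⟩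
    · simp only [Category.assoc, biprod.lift_fst, Preadditive.add_comp, hq, ha, hs₂]
      abel
    · simp only [Category.assoc, biprod.lift_snd, Preadditive.add_comp]
      rw [← Category.assoc c, dist_comp₂₃ hT, zero_comp, comp_zero, comp_zero, add_zero, hg',
        ← Category.assoc, hy, Category.assoc, ← Functor.map_comp, ← Category.assoc, hr,
        Category.assoc, ha]
  obtain ⟨y, hy⟩ := exists_unshift (x ≫ w)
  have hy₀ := inj y (unshift_comp_eq_zero y _ (by
    rw [← hy, Category.assoc, dist_comp₃₁ hX, comp_zero]))
  rw [hy₀, Functor.map_zero, comp_zero] at hy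
  obtain ⟨f, rfl⟩ := dist_lift₃ hX x hy
  obtain ⟨y, rfl⟩ := surj f
  rw [Category.assoc, dist_comp₁₂ hX, comp_zero]

end Splitting

/-! ### Finiteness and vanishing imply membership in the closure -/

section Representability

variable {C : Type u} [Category.{v} C] [Preadditive C] [HasZeroObject C] [HasShift C ℤ]
  [∀ n : ℤ, (shiftFunctor C n).Additive] [Pretriangulated C] [HasCoproducts.{v} C]
  {G R : ℤ → ObjectProperty C} {A : ℕ}

lemma IsQuasiapproximableWith.eq_zero_of_metricR (h : IsQuasiapproximableWith G R A)
    (hG : IsGeneratingSequence G) {b n : ℤ} {F Q : C} (hF : metricR G b F) (hQ : G n Q)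
    (hn : 2 * A - b + 2 ≤ n) : (∀ f : Q ⟶ F, f = 0) ∧ (∀ f : Q⟦(-1 : ℤ)⟧ ⟶ F, f = 0) ∧
      ∀ f : Q⟦(-1 : ℤ)⟧⟦(-1 : ℤ)⟧ ⟶ F, f = 0 := by
  have h₀ (F : C) (hF : metricR G (b - 2) F) : ∀ f : Q ⟶ F, f = 0 :=
    h.vanishesFrom_of_metricR hF n (by lia) Q hQ
  have h₁ (F : C) (hF : metricR G (b - 1) F) : ∀ f : Q⟦(-1 : ℤ)⟧ ⟶ F, f = 0 :=
    (forall_shift_eq_zero_iff (m := 1) (by simp)).2 (h₀ _ (metricR_shift_pos hG _ F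
      (metricR_anti G (by lia) _ hF)))
  exact ⟨h₀ F (metricR_anti G (by lia) _ hF), h₁ F (metricR_anti G (by lia) _ hF),
    (forall_shift_eq_zero_iff (m := 1) (by simp)).2 (h₁ _ (metricR_shift_pos hG _ F
      (metricR_anti G (by lia) _ hF)))⟩

variable [IsTriangulated C] {k : Type w} [CommRing k] [Linear k C] [IsNoetherianRing k]
  [∀ n : ℤ, (shiftFunctor C n).Linear k]

lemma IsQuasiapproximableWith.closureG_biprod_shift (h : IsQuasiapproximableWith G R A)
    (hC : IsCompactlyGenerated C) (hG : IsFiniteGeneratingSequence G)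
    (hhom : compacts C ≤ HomFinite k) {F : C} (hF : HomFinite k F) {N : ℤ}
    (hN : VanishesFrom G N F) : closureG G (F ⊞ F⟦(1 : ℤ)⟧) := by
  intro l
  obtain ⟨b, hb⟩ : ∃ b : ℤ, b = -2 * A - N := ⟨_, rfl⟩
  have hFb : metricR G b F := hb ▸ h.metricR_of_vanishesFrom hC hG hhom hF hN
  have hfac {E : C} (x : E ⟶ F) (hE : compacts C E) : ∃ (K : C) (x' : K ⟶ F) (t : E ⟶ K),
      t ≫ x' = x ∧ compacts C K ∧ metricR G b K := by
    obtain ⟨K, x', t, ht, hK, hK'⟩ := h.exists_factorization hG.1 hN x hE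
    exact ⟨K, x', t, ht, hK, metricR_anti G (by lia) _ hK'⟩
  -- Generators of larger index, together with their first two desuspensions, have no maps to
  -- objects of R^G_b, so only finitely many test objects remain.
  let V : Set C := ⋃ n ∈ Set.Icc (-2 * A - l) (2 * A - b + 2), ({X : C | G n X} ∪
    (fun X ↦ X⟦(-1 : ℤ)⟧) '' {X : C | G n X} ∪
    (fun X ↦ X⟦(-1 : ℤ)⟧⟦(-1 : ℤ)⟧) '' {X : C | G n X})
  have hV : V.Finite := (Set.finite_Icc _ _).biUnion fun n _ ↦
    ((hG.finite n).union ((hG.finite n).image _)).union ((hG.finite n).image _)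
  have hVmem {n : ℤ} {Q : C} (hn : -2 * A - l ≤ n) (hn' : n ≤ 2 * A - b + 2) (hQ : G n Q) :
      Q ∈ V ∧ Q⟦(-1 : ℤ)⟧ ∈ V ∧ Q⟦(-1 : ℤ)⟧⟦(-1 : ℤ)⟧ ∈ V :=
    ⟨Set.mem_biUnion ⟨hn, hn'⟩ (Or.inl (Or.inl hQ)),
      Set.mem_biUnion ⟨hn, hn'⟩ (Or.inl (Or.inr ⟨Q, hQ, rfl⟩)),
      Set.mem_biUnion ⟨hn, hn'⟩ (Or.inr ⟨Q, hQ, rfl⟩)⟩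
  -- Enough steps for `D`, and then for the compact `K`, to be invisible to the desuspensions of G^n
  -- for all n ≥ -2A - l.
  obtain ⟨m, hm⟩ : ∃ m : ℕ, A + 1 + 2 * A + l ≤ b - A + m :=
    ⟨(A + 1 + 2 * A + l - b + A).toNat, by lia⟩
  obtain ⟨E, x, hE, hx⟩ := HasCompactCovers.approxClass hhom hG A (b - A) m F hF
  obtain ⟨E', x', t, ht, hE', hsurj, -⟩ := hF.exists_extension hhom hV hE x
  obtain ⟨E₀, p₀, t', ht', hE₀, hE₀b⟩ := hfac x' hE'
  have hcov {B : C} (hB : approxClass G A (b - A) m B) (f : B ⟶ F) : ∃ g : B ⟶ E₀, g ≫ p₀ = f := by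
    obtain ⟨g, hg⟩ := hx B hB f
    exact ⟨g ≫ t ≫ t', by rw [Category.assoc, Category.assoc, ht', ht, hg]⟩
  have hs {Q : C} (hQ : Q ∈ V) (hQ' : compacts C Q) (f : Q ⟶ F) : ∃ s : Q ⟶ E₀, s ≫ p₀ = f := by
    obtain ⟨g, hg⟩ := hsurj Q hQ hQ' f
    exact ⟨g ≫ t', by rw [Category.assoc, ht', hg]⟩
  obtain ⟨E₁', x₁, u, hu, hE₁', -, hker⟩ := hF.exists_extension hhom hV hE₀ p₀
  obtain ⟨E₁, p₁, u', hu', hE₁, hE₁b⟩ := hfac x₁ hE₁'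
  have ha : (u ≫ u') ≫ p₁ = p₀ := by rw [Category.assoc, hu', hu]
  have hk {Q : C} (hQ : Q ∈ V) (hQ' : compacts C Q) (s : Q ⟶ E₀) (hs : s ≫ p₀ = 0) :
      s ≫ u ≫ u' = 0 := by
    rw [← Category.assoc, hker Q hQ hQ' s hs, zero_comp]
  obtain ⟨B, D, i, r, c, hT, hB, hD, hD'⟩ := h.exists_approx (b - A) m
    (h.metricR_le (by lia) _ hE₁b) (closureG_of_compacts hE₁)
  obtain ⟨d, hd⟩ : ∃ d : ℤ, d = b - A + m := ⟨_, rfl⟩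
  rw [← hd] at hD hm
  obtain ⟨v₀, hv₀⟩ := hcov hB (i ≫ p₁)
  obtain ⟨l', hl'⟩ := h.exists_metricR_eq_zero_of_compacts hG.1 hE₁
  obtain ⟨K, W, f, g, w, hK, hKc, hW⟩ := hD' (max l' (d + A + 1))
  obtain ⟨κ, hκ⟩ := dist_lift₂ hK r (hl' _ (le_max_left _ _) W hW _)
  have hKd : R d K := h.metric.obj₂ (inv_rot_of_distTriang _ hK) (h.metricR_le le_rfl _
    (metricR_shift_neg hG.1 (d + A) W (metricR_anti G (le_max_right _ _) _ hW))) hD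
  -- `B` need not be compact. The compact fibre `P` of E₁ → K replaces it and maps to it, so the
  -- lift of `B` to E₀ restricts to `P`.
  obtain ⟨P, ι, δ, hP⟩ := distinguished_cocone_triangle₁ κ
  have hPc : compacts C P := compacts_obj₁ hP hE₁ hKc
  obtain ⟨σ, hσ⟩ := dist_lift₂ hT ι (by
    rw [← hκ, ← Category.assoc, dist_comp₁₂ hP, zero_comp])
  have hv : (σ ≫ v₀) ≫ p₀ = ι ≫ p₁ := by rw [Category.assoc, hv₀, ← Category.assoc, hσ]
  obtain ⟨T, c', d', hT'⟩ := distinguished_cocone_triangle (ι - (σ ≫ v₀) ≫ u ≫ u')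
  obtain ⟨q, hq⟩ := dist_desc₂ hT' p₁ (by
    rw [Preadditive.sub_comp, Category.assoc _ (u ≫ u'), ha, hv, sub_self])
  have hTc : compacts C T := compacts_obj₃ hT' hPc hE₁
  obtain ⟨X, g', w', hX⟩ := distinguished_cocone_triangle
    (biprod.lift q (d' ≫ (ι ≫ p₁)⟦(1 : ℤ)⟧'))
  refine ⟨T, X, _, _, _, hX, hTc, ?_⟩
  have hXF : HomFinite k X := HomFinite.obj₂ (rot_of_distTriang _ hX) (hF.biprod (hF.shift 1))
    ((hhom _ hTc).shift 1)
  suffices hXN : VanishesFrom G (-2 * A - l) X by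
    have := h.metricR_of_vanishesFrom hC hG hhom hXF hXN
    rwa [show -2 * A - (-2 * A - l) = l by lia] at this
  intro n hn Q hQ
  have hQc := hG.le_compacts n Q hQ
  have hQc' := compacts_shift hQc (-1)
  have hQc'' := compacts_shift hQc' (-1)
  have hQK : ∀ f : Q⟦(-1 : ℤ)⟧ ⟶ K, f = 0 := (forall_shift_eq_zero_iff (m := 1) (by simp)).2
    fun f ↦ h.hom_eq_zero_of_le n (d - 1) (by lia) _
      (h.metric.shift_pos (d - 1) K (by simpa using hKd)) f hQ
  by_cases hn' : n ≤ 2 * A - b + 2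
  · obtain ⟨hQ₀, hQ₁, hQ₂⟩ := hVmem hn hn' hQ
    exact eq_zero_of_biprod_cone ha hP hv hT' hq hX (hs hQ₀ hQc) (hs hQ₁ hQc') (hk hQ₁ hQc')
      (hk hQ₂ hQc'') hQK
  · obtain ⟨hF₀, hF₁, -⟩ := h.eq_zero_of_metricR hG.1 hFb hQ (by lia)
    obtain ⟨-, h₁, h₂⟩ := h.eq_zero_of_metricR hG.1 hE₀b hQ (by lia)
    exact eq_zero_of_biprod_cone ha hP hv hT' hq hX
      (fun f ↦ ⟨0, by rw [hF₀ f, zero_comp]⟩) (fun f ↦ ⟨0, by rw [hF₁ f, zero_comp]⟩)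
      (fun s _ ↦ by rw [h₁ s, zero_comp]) (fun s _ ↦ by rw [h₂ s, zero_comp]) hQK

/-- For each l some odd shift F⟦2t+1⟧ lies in R^G_{l+1}. The triangle F⟦2t+1⟧ ⊞ F → F → F⟦2t+2⟧ then
puts F in T^c ⋆ R^G_l ⋆ R^G_l. -/
lemma IsQuasiapproximableWith.closureG_of_vanishesFrom (h : IsQuasiapproximableWith G R A)
    (hC : IsCompactlyGenerated C) (hG : IsFiniteGeneratingSequence G)
    (hhom : compacts C ≤ HomFinite k) {F : C} (hF : HomFinite k F) {N : ℤ}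
    (hN : VanishesFrom G N F) : closureG G F := by
  intro l
  obtain ⟨t, ht⟩ := h.exists_odd_shift hG.1 (-2 * A - N) (l + 1)
  have h₁ := h.closureG_biprod_odd_shift hG.1 (h.closureG_biprod_shift hC hG hhom hF hN) t
  have h₂ := ht F (h.metricR_of_vanishesFrom hC hG hhom hF hN)
  have h₃ : ((compacts C).extensionProduct (metricR G l)).extensionProduct (metricR G l) F :=
    ⟨_, _, _, _, _, rot_of_distTriang _ (binaryBiproductTriangle_distinguished (F⟦2 * t + 1⟧) F),
      closureG_iso (biprod.braiding _ _) h₁ l, metricR_shift_pos hG.1 l _ h₂⟩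
  rw [ObjectProperty.extensionProduct_assoc] at h₃
  refine ObjectProperty.monotone_extensionProduct_right _ ?_ _ h₃
  rintro X ⟨_, _, _, _, _, hT, hX₁, hX₃⟩
  exact metricR_obj₂ hT hX₁ hX₃

end Representability

/-! ### Invariance of semifiniteness under isomorphism -/

section Semifinite

variable {C : Type u} [Category.{v} C] [Preadditive C] [HasZeroObject C] [HasShift C ℤ]
  [∀ n : ℤ, (shiftFunctor C n).Additive] [Pretriangulated C] {k : Type w} [CommRing k]
  [Linear k C] {H H' : (compacts C).FullSubcategoryᵒᵖ ⥤ ModuleCat.{v} k}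

lemma IsCohomological.of_iso (e : H ≅ H') (hH : IsCohomological k H) : IsCohomological k H' where
  additive := by
    have := hH.additive
    exact Functor.additive_of_iso e
  map_smul {X Y} r f := by
    rw [← cancel_epi (e.hom.app (op Y)), ← e.hom.naturality, hH.map_smul, Linear.smul_comp,
      Linear.comp_smul, e.hom.naturality]
  exact {X Y Z} f g h hT := by
    have hex := hH.exact f g h hT
    have hnat {X Y : (compacts C).FullSubcategory} (f : X ⟶ Y) (y : H'.obj (op Y)) :
        (H.map f.op).hom ((e.inv.app (op Y)).hom y) = (e.inv.app (op X)).hom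
          ((H'.map f.op).hom y) :=
      (DFunLike.congr_fun (congrArg ModuleCat.Hom.hom (e.inv.naturality f.op)) y).symm
    have hnat' {X Y : (compacts C).FullSubcategory} (f : X ⟶ Y) (y : H.obj (op Y)) :
        (H'.map f.op).hom ((e.hom.app (op Y)).hom y) = (e.hom.app (op X)).hom
          ((H.map f.op).hom y) :=
      (DFunLike.congr_fun (congrArg ModuleCat.Hom.hom (e.hom.naturality f.op)) y).symm
    have hinv (X : (compacts C).FullSubcategory) (y : H'.obj (op X)) :
        (e.hom.app (op X)).hom ((e.inv.app (op X)).hom y) = y :=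
      DFunLike.congr_fun (congrArg ModuleCat.Hom.hom (e.inv_hom_id_app (op X))) y
    intro y
    constructor
    · intro hy
      obtain ⟨z, hz⟩ := (hex ((e.inv.app (op Y)).hom y)).1 (by rw [hnat, hy, map_zero])
      exact ⟨(e.hom.app (op Z)).hom z, by rw [hnat', hz, hinv]⟩
    · rintro ⟨z, rfl⟩
      have h₀ := (hex _).2 ⟨(e.inv.app (op Z)).hom z, rfl⟩
      rw [hnat, hnat] at h₀
      rw [← hinv X ((H'.map f.op).hom _), h₀, map_zero]

lemma IsSemifinite.of_iso {G : ℤ → ObjectProperty C} (e : H ≅ H') (hH : IsSemifinite k G H) :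
    IsSemifinite k G H' where
  toIsCohomological := hH.toIsCohomological.of_iso e
  finite X := by
    have := hH.finite X
    exact Module.Finite.equiv (e.app (op X)).toLinearEquiv
  vanishing := by
    obtain ⟨N, hN⟩ := hH.vanishing
    refine ⟨N, fun i hi X hX ↦ ?_⟩
    have := hN i hi X hX
    exact (e.app (op X)).toLinearEquiv.symm.injective.subsingleton

end Semifinite

end GApprox

end

theorem mainTheorem1 {C : Type u} [Category.{v} C] [Preadditive C] [HasZeroObject C]
    [HasShift C ℤ] [∀ n : ℤ, (shiftFunctor C n).Additive] [Pretriangulated C]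
    [IsTriangulated C] [HasCoproducts.{v} C]
    (k : Type w) [CommRing k] [IsNoetherianRing k] [Linear k C]
    [∀ n : ℤ, (shiftFunctor C n).Linear k]
    (hC : GApprox.IsCompactlyGenerated C)
    (G : ℤ → ObjectProperty C) (hG : GApprox.IsFiniteGeneratingSequence G)
    (hT : GApprox.IsQuasiapproximable G)
    (hfin : ∀ (m n : ℤ) (X Y : C), G m X → G n Y → Module.Finite k (X ⟶ Y)) :
    (∀ H : (GApprox.compacts C).FullSubcategoryᵒᵖ ⥤ ModuleCat.{v} k,
      (GApprox.restrictedYoneda k G).essImage H ↔ GApprox.IsSemifinite k G H) ∧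
    (GApprox.restrictedYoneda k G).Full := by
  obtain ⟨R, A, h⟩ := hT
  have hhom := GApprox.homFinite_of_compacts (k := k) hG.1 hfin
  refine ⟨fun H ↦ ⟨?_, fun hH ↦ ?_⟩, ⟨fun {F F'} η ↦ ?_⟩⟩
  · rintro ⟨F, ⟨e⟩⟩
    refine GApprox.IsSemifinite.of_iso e ?_
    obtain ⟨N, hN⟩ := h.exists_vanishesFrom hG.1 F.2
    exact
      { toIsCohomological := GApprox.isCohomological_yonedaCompacts F.obj
        finite := fun X ↦ h.homFinite hG.1 hhom F.2 X.obj X.2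
        vanishing := ⟨N, fun i hi X hX ↦ ⟨fun a b ↦
          (hN i hi X.obj hX a).trans (hN i hi X.obj hX b).symm⟩⟩ }
  -- No depth condition on the terms is needed here: semifiniteness of `H` passes to Hom(-, L), and
  -- this alone puts `L` in the closure.
  · obtain ⟨S, -, hS⟩ := GApprox.exists_approxSeq hH.toIsCohomological hH.finite
      (fun X Y hX hY ↦ hhom Y hY X hX) hG ⊤ (fun E x ↦ ⟨E, x, 𝟙 _, GApprox.pull_id x, trivial⟩)
    obtain ⟨L, i, hL⟩ := GApprox.exists_isHocolim (S.X ⋙ (GApprox.compacts C).ι)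
    obtain ⟨e⟩ := GApprox.exists_iso_of_isHocolim hH.toIsCohomological S hS hL
    have hL' : GApprox.IsSemifinite k G (GApprox.yonedaCompacts k L) := hH.of_iso e.symm
    obtain ⟨N, hN⟩ := hL'.vanishing
    have hLcl : GApprox.closureG G L := h.closureG_of_vanishesFrom hC hG hhom
      (fun X hX ↦ hL'.finite ⟨X, hX⟩) (N := N) fun n hn X hX f ↦
        (hN n hn ⟨X, hG.le_compacts n X hX⟩ hX).elim f 0
    exact ⟨⟨L, hLcl⟩, ⟨e⟩⟩
  · obtain ⟨X, x, hX, hX'⟩ := GApprox.exists_isHocolim_of_homFinite hC hG hhom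
      (h.homFinite hG.1 hhom F.2) ⊤ (fun E x hE ↦ ⟨E, x, 𝟙 E, Category.id_comp x, hE, trivial⟩)
    obtain ⟨f, hf⟩ := GApprox.exists_map_eq_of_isHocolim (k := k) hX (fun j ↦ (hX' j).1) η
    exact ⟨ObjectProperty.homMk f, hf⟩
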